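/- Let $G$ be a non-discrete locally compact (Hausdorff) group with left Haar measure $\lambda$, let $1\le p<\infty$ and let $q\in(1,\infty]$ be the conjugate index, $1/p+1/q=1$ (with $d/q=0$ if $q=\infty$). For a measurable $\omega:G\to[1,\infty)$ put $$\mathcal A=L^p(G,\omega)\cap L^2(G),\qquad \|f\|_{\mathcal A}=\max\{\|f\omega\|_p,\|f\|_2\},$$ and let $\widetilde{\mathcal A}=\mathcal A\times\mathbb C$, with $\|(f,t)\|=\|f\|_{\mathcal A}+|t|$ and product $(f,t)(g,s)=(f*g+sf+tg,\,ts)$, be its unitization, where $(f*g)(x)=\int_G f(y)\,g(y^{-1}x)\,d\lambda(y)$. Suppose that one of the following holds. (i) There are compact subgroups $G_1\subseteq G_2\subseteq\cdots$ of $G$ with $G=\bigcup_i G_i$ and numbers $1\le n_1\le n_2\le\cdots$ such that $\omega=1+\sum_{i} n_i 1_{G_{i+1}\setminus G_i}$, and $\omega^{-1}\in L^s(G)$ for some $0<s<q$. In (ii)–(iv), $G$ is compactly generated, $U$ is a compact symmetric generating neighbourhood of the identity $e$, and $\tau(x)=\min\{n\ge 0: x\in U^n\}$ (with $U^0=\{e\}$).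 (ii) $G$ has polynomial growth, and $\omega(x)=(1+\tau(x))^\beta$ with $\beta>0$ and $\beta>d(G)/q$. Here polynomial growth means that $\lambda(V^n)=O(n^d)$ for some integer $d\ge0$, and $d(G)$ is the least such $d$. (iii) $G$ has polynomial growth, and $\omega(x)=e^{C\tau(x)^\alpha}$ with $0<\alpha<1$ and $C>0$. (iv) $G$ has intermediate growth (it is not of polynomial growth, but for every $\varepsilon>0$ one has $\lambda(V^n)=O(e^{\varepsilon n})$), its growth is bounded by $e^{n^{\alpha_0}}$, i.e. $\lambda(V^n)=O(e^{n^{\alpha_0}})$, and $\omega(x)=e^{C\tau(x)^\alpha}$ with $0<\alpha_0<\alpha<1$ and $C>0$. (In these growth conditions $V$ is some compact symmetric generating neighbourhood of $e$, not necessarily $U$.) Then $\widetilde{\mathcal A}$ is a unital Banach algebra (complete, with $\|ab\|\le \mathrm{const}\cdot\|a\|\,\|b\|$), the map sending $(f,t)$ to the operator $g\mapsto f*g+tg$ is a continuous injective unital algebra homomorphism $\widetilde{\mathcal A}\to B(L^2(G))$, and $\widetilde{\mathcal A}$ admits norm-controlled inversion in $B(L^2(G))$. That is, every $a\in\widetilde{\mathcal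 A}$ that is invertible in $B(L^2(G))$ is invertible in $\widetilde{\mathcal A}$, and there is a function $h:[0,\infty)^2\to[0,\infty)$ (depending only on $G,\lambda,p,\omega$) such that for all such $a$ $$\|a^{-1}\|_{\widetilde{\mathcal A}}\le h\bigl(\|a\|_{\widetilde{\mathcal A}},\|a^{-1}\|_{B(L^2(G))}\bigr).$$ -/

import Mathlib

open MeasureTheory Topology
open scoped ENNReal NNReal Pointwise

/-! ### Norm-controlled inversion -/

/-- A complex unital Banach algebra structure on the normed space `X`. The product is a
bounded bilinear map, i.e. `‖ab‖ ≤ C ‖a‖ ‖b‖` for some constant `C`, not necessarily `1`. -/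
structure UnitalBanachAlgebra (X : Type*) [NormedAddCommGroup X] [NormedSpace ℂ X] where
  mul : X →L[ℂ] X →L[ℂ] X
  one : X
  mul_assoc : ∀ a b c, mul (mul a b) c = mul a (mul b c)
  one_mul : ∀ a, mul one a = a
  mul_one : ∀ a, mul a one = a
  complete : CompleteSpace X

namespace UnitalBanachAlgebra

variable {X : Type*} [NormedAddCommGroup X] [NormedSpace ℂ X]

/-- `b` is the two-sided inverse of `a`. -/
def IsInverse (𝔄 : UnitalBanachAlgebra X) (a b : X) : Prop :=
  𝔄.mul a b = 𝔄.one ∧ 𝔄.mul b a = 𝔄.one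

/-- A continuous embedding of a unital Banach algebra in the Banach algebra `B`, with common
unit. -/
structure Embedding (𝔄 : UnitalBanachAlgebra X) (B : Type*) [NormedRing B]
    [NormedAlgebra ℂ B] where
  toCLM : X →L[ℂ] B
  injective : Function.Injective toCLM
  map_mul : ∀ a b, toCLM (𝔄.mul a b) = toCLM a * toCLM b
  map_one : toCLM 𝔄.one = 1

/-- The algebra is inverse-closed in `B` and the norm of an inverse `a⁻¹` in the algebra is
bounded by a function `h` of the norm of `a` in the algebra and the norm of `a⁻¹` in `B`. -/
def Embedding.AdmitsNormControlledInversion {𝔄 : UnitalBanachAlgebra X} {B : Type*}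
    [NormedRing B] [NormedAlgebra ℂ B] (ι : 𝔄.Embedding B) : Prop :=
  (∀ a : X, IsUnit (ι.toCLM a) → ∃ b : X, 𝔄.IsInverse a b) ∧
  ∃ h : ℝ≥0 → ℝ≥0 → ℝ≥0, ∀ a b : X, 𝔄.IsInverse a b → ‖b‖₊ ≤ h ‖a‖₊ ‖ι.toCLM b‖₊

end UnitalBanachAlgebra

/-! ### The space `L^p(G,ω) ∩ L^2(G)` and its unitization -/

section Weighted

variable {G : Type*} [MeasurableSpace G]

/-- `L^p(G,ω) ∩ L^2(G)` as a linear subspace of `L^2(G)`. -/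
def weightedSubmodule (p : ℝ≥0∞) (ω : G → ℝ) (μ : Measure G) :
    Submodule ℂ (Lp ℂ 2 μ) where
  carrier := {f | MemLp (fun x => (ω x : ℂ) * f x) p μ}
  zero_mem' := by
    have h : (fun x => (ω x : ℂ) * (0 : Lp ℂ 2 μ) x) =ᵐ[μ] (0 : G → ℂ) := by
      filter_upwards [Lp.coeFn_zero ℂ 2 μ] with x hx
      rw [hx]
      simp
    exact (memLp_congr_ae h).2 MemLp.zero
  add_mem' := by
    intro f g hf hg
    have h : (fun x => (ω x : ℂ) * (f + g : Lp ℂ 2 μ) x) =ᵐ[μ]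
        (fun x => (ω x : ℂ) * f x) + (fun x => (ω x : ℂ) * g x) := by
      filter_upwards [Lp.coeFn_add f g] with x hx
      rw [hx]
      simp [mul_add]
    exact (memLp_congr_ae h).2 (MemLp.add hf hg)
  smul_mem' := by
    intro c f hf
    have h : (fun x => (ω x : ℂ) * (c • f : Lp ℂ 2 μ) x) =ᵐ[μ]
        c • (fun x => (ω x : ℂ) * f x) := by
      filter_upwards [Lp.coeFn_smul c f] with x hx
      rw [hx]
      simp [mul_left_comm]
    exact (memLp_congr_ae h).2 (MemLp.const_smul hf c)

/-- The space `L^p(G,ω) ∩ L^2(G)`; a type of its own, since its norm is not that of `L^2(G)`. -/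
def WeightedSpace (p : ℝ≥0∞) (ω : G → ℝ) (μ : Measure G) : Type _ :=
  ↥(weightedSubmodule p ω μ)

namespace WeightedSpace

variable {p : ℝ≥0∞} {ω : G → ℝ} {μ : Measure G}

noncomputable instance : AddCommGroup (WeightedSpace p ω μ) :=
  inferInstanceAs (AddCommGroup ↥(weightedSubmodule p ω μ))

noncomputable instance : Module ℂ (WeightedSpace p ω μ) :=
  inferInstanceAs (Module ℂ ↥(weightedSubmodule p ω μ))

/-- The inclusion in `L^2(G)`. -/
noncomputable def toL2 : WeightedSpace p ω μ →ₗ[ℂ] Lp ℂ 2 μ :=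
  (weightedSubmodule p ω μ).subtype

/-- `‖f‖_{p,ω} = ‖f ω‖_p`, as an extended nonnegative number. -/
noncomputable def wnorm (f : WeightedSpace p ω μ) : ℝ≥0∞ :=
  eLpNorm (fun x => (ω x : ℂ) * toL2 f x) p μ

theorem wnorm_lt_top (f : WeightedSpace p ω μ) : wnorm f < ∞ := (show MemLp _ p μ from f.2).2

/-- `‖f‖ = max (‖f‖_{p,ω}, ‖f‖_2)`. -/
noncomputable instance : Norm (WeightedSpace p ω μ) :=
  ⟨fun f => max (wnorm f).toReal ‖toL2 f‖⟩

theorem norm_def (f : WeightedSpace p ω μ) : ‖f‖ = max (wnorm f).toReal ‖toL2 f‖ := rfl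

theorem wnorm_smul (c : ℂ) (f : WeightedSpace p ω μ) : wnorm (c • f) = ‖c‖ₑ * wnorm f := by
  have h : (fun x => (ω x : ℂ) * toL2 (c • f) x) =ᵐ[μ]
      c • (fun x => (ω x : ℂ) * toL2 f x) := by
    filter_upwards [Lp.coeFn_smul c (toL2 f)] with x hx
    rw [map_smul, hx]
    simp [mul_left_comm]
  rw [wnorm, eLpNorm_congr_ae h, eLpNorm_const_smul, wnorm]

theorem wnorm_add_le (hp : 1 ≤ p) (f g : WeightedSpace p ω μ) :
    wnorm (f + g) ≤ wnorm f + wnorm g := by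
  have h : (fun x => (ω x : ℂ) * toL2 (f + g) x) =ᵐ[μ]
      (fun x => (ω x : ℂ) * toL2 f x) + (fun x => (ω x : ℂ) * toL2 g x) := by
    filter_upwards [Lp.coeFn_add (toL2 f) (toL2 g)] with x hx
    rw [map_add, hx]
    simp [mul_add]
  rw [wnorm, eLpNorm_congr_ae h]
  exact eLpNorm_add_le (show MemLp _ p μ from f.2).1 (show MemLp _ p μ from g.2).1 hp

theorem normedSpaceCore [Fact (1 ≤ p)] : NormedSpace.Core ℂ (WeightedSpace p ω μ) where
  norm_nonneg f := le_max_of_le_right (norm_nonneg _)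
  norm_smul c f := by
    rw [norm_def, norm_def, wnorm_smul, map_smul, norm_smul, ENNReal.toReal_mul,
      mul_max_of_nonneg _ _ (norm_nonneg c), toReal_enorm]
  norm_triangle f g := by
    rw [norm_def, norm_def, norm_def, map_add]
    refine max_le ?_ ?_
    · refine le_trans (ENNReal.toReal_mono ?_ (wnorm_add_le Fact.out f g)) ?_
      · exact ENNReal.add_ne_top.2 ⟨(wnorm_lt_top f).ne, (wnorm_lt_top g).ne⟩
      · rw [ENNReal.toReal_add (wnorm_lt_top f).ne (wnorm_lt_top g).ne]
        exact add_le_add (le_max_left _ _) (le_max_left _ _)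
    · exact (norm_add_le _ _).trans (add_le_add (le_max_right _ _) (le_max_right _ _))
  norm_eq_zero_iff f := by
    constructor
    · intro h
      have h2 : ‖toL2 f‖ ≤ 0 := h ▸ le_max_right _ _
      exact Subtype.ext (norm_le_zero_iff.1 h2)
    · rintro rfl
      have h0 : wnorm (0 : WeightedSpace p ω μ) = 0 := by
        simpa using wnorm_smul (0 : ℂ) (0 : WeightedSpace p ω μ)
      simp [norm_def, h0]

noncomputable instance [Fact (1 ≤ p)] : NormedAddCommGroup (WeightedSpace p ω μ) :=
  NormedAddCommGroup.ofCore normedSpaceCore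

noncomputable instance [Fact (1 ≤ p)] : NormedSpace ℂ (WeightedSpace p ω μ) :=
  NormedSpace.ofCore normedSpaceCore

end WeightedSpace

/-- The unitization, as a normed space: pairs `(f, t)` with `‖(f, t)‖ = ‖f‖ + |t|`. -/
abbrev UnitizedSpace (p : ℝ≥0∞) (ω : G → ℝ) (μ : Measure G) : Type _ :=
  WithLp 1 (WeightedSpace p ω μ × ℂ)

theorem UnitizedSpace.norm_def {p : ℝ≥0∞} [Fact (1 ≤ p)] {ω : G → ℝ} {μ : Measure G}
    (a : UnitizedSpace p ω μ) : ‖a‖ = ‖a.fst‖ + ‖a.snd‖ :=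
  WithLp.prod_norm_eq_of_L1 a

/-- `h` is the convolution `f ∗ g`: for almost every `x` the integral
`∫ f(y) g(y⁻¹ x) dy` converges absolutely and equals `h(x)`. -/
def IsConvolution [Group G] (μ : Measure G) (f g h : G → ℂ) : Prop :=
  ∀ᵐ x ∂μ, Integrable (fun y => f y * g (y⁻¹ * x)) μ ∧
    h x = ∫ y, f y * g (y⁻¹ * x) ∂μ

/-- The algebra structure on the unitization is the one given by convolution: the unit is
`(0, 1)` and `(f, t)(g, s) = (f ∗ g + s f + t g, t s)`. -/
def IsConvolutionUnitization [Group G] {p : ℝ≥0∞} [Fact (1 ≤ p)] {ω : G → ℝ} {μ : Measure G}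
    (𝔄 : UnitalBanachAlgebra (UnitizedSpace p ω μ)) : Prop :=
  𝔄.one = WithLp.toLp 1 (0, 1) ∧
  ∀ a b : UnitizedSpace p ω μ, ∃ k : WeightedSpace p ω μ,
    IsConvolution μ a.fst.toL2 b.fst.toL2 k.toL2 ∧
    𝔄.mul a b = WithLp.toLp 1 (k + b.snd • a.fst + a.snd • b.fst, a.snd * b.snd)

/-- The embedding in `B(L^2(G))` is the natural one: `(f, t)` acts on `L^2(G)` by
`g ↦ f ∗ g + t g`. -/
def IsConvolutionAction [Group G] {p : ℝ≥0∞} [Fact (1 ≤ p)] {ω : G → ℝ} {μ : Measure G}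
    {𝔄 : UnitalBanachAlgebra (UnitizedSpace p ω μ)}
    (ι : 𝔄.Embedding (Lp ℂ 2 μ →L[ℂ] Lp ℂ 2 μ)) : Prop :=
  ∀ (a : UnitizedSpace p ω μ) (g : Lp ℂ 2 μ), ∃ k : Lp ℂ 2 μ,
    IsConvolution μ a.fst.toL2 g k ∧ ι.toCLM a g = k + a.snd • g

end Weighted

/-! ### Length functions, growth and weights -/

section Growth

variable {G : Type*} [Group G]

/-- `ω = 1 + ∑ i, n i • 1_{K (i+1) \ K i}`. -/
noncomputable def stepWeight (K : ℕ → Subgroup G) (n : ℕ → ℝ) (x : G) : ℝ :=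
  1 + ∑' i, ((K (i + 1) : Set G) \ (K i : Set G)).indicator (fun _ => n i) x

/-- The length `τ_U(x)`: the least `n` with `x ∈ U^n`. Here `U^0 = {1}`, so `τ_U(1) = 0`. -/
noncomputable def lengthFun (U : Set G) (x : G) : ℕ := sInf {n : ℕ | x ∈ U ^ n}

/-- The polynomial weight `(1 + τ(x))^β`. -/
noncomputable def polyWeight (U : Set G) (β : ℝ) (x : G) : ℝ := (1 + (lengthFun U x : ℝ)) ^ β

/-- The subexponential weight `exp (C τ(x)^α)`. -/
noncomputable def subexpWeight (U : Set G) (α C : ℝ) (x : G) : ℝ :=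
  Real.exp (C * (lengthFun U x : ℝ) ^ α)

variable [TopologicalSpace G]

/-- `U` is a compact symmetric generating neighbourhood of the identity. -/
structure IsGeneratingNhd (U : Set G) : Prop where
  isCompact : IsCompact U
  mem_nhds : U ∈ 𝓝 (1 : G)
  inv_eq : U⁻¹ = U
  closure_eq_top : Subgroup.closure U = ⊤

variable [MeasurableSpace G]

/-- `μ (U^n) = O(n^d)` for a compact symmetric generating neighbourhood `U` (equivalently,
for every such `U`). -/
def HasGrowthOfDegreeLE (μ : Measure G) (d : ℕ) : Prop :=
  ∃ U : Set G, IsGeneratingNhd U ∧ ∃ C : ℝ, ∀ n : ℕ, 1 ≤ n →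
    μ (U ^ n) ≤ ENNReal.ofReal (C * (n : ℝ) ^ d)

/-- Compactly generated of polynomial growth. -/
def HasPolynomialGrowth (μ : Measure G) : Prop := ∃ d, HasGrowthOfDegreeLE μ d

/-- The order of growth `d(G)`. -/
noncomputable def growthOrder (μ : Measure G) : ℕ := sInf {d | HasGrowthOfDegreeLE μ d}

/-- Compactly generated of intermediate growth: not of polynomial growth, but `μ (U^n)` grows
slower than every exponential function of `n`. -/
def HasIntermediateGrowth (μ : Measure G) : Prop :=
  ¬ HasPolynomialGrowth μ ∧
  ∃ U : Set G, IsGeneratingNhd U ∧ ∀ ε : ℝ, 0 < ε → ∃ C : ℝ, ∀ n : ℕ, 1 ≤ n →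
    μ (U ^ n) ≤ ENNReal.ofReal (C * Real.exp (ε * n))

/-- The growth is bounded by `exp (n^a)`, up to a constant factor. -/
def HasGrowthBoundedByExpPow (μ : Measure G) (a : ℝ) : Prop :=
  ∃ U : Set G, IsGeneratingNhd U ∧ ∃ C : ℝ, ∀ n : ℕ, 1 ≤ n →
    μ (U ^ n) ≤ ENNReal.ofReal (C * Real.exp ((n : ℝ) ^ a))

end Growth

/-! Write $\mathcal A=L^p(G,\omega)\cap L^2(G)$. Each weight satisfies $\omega(xy)\le
C(\omega(x)\sigma(y)+\sigma(x)\omega(y))$ with a much smaller weight $\sigma$, and $\|f\sigma\|_1\le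
D\|f\omega\|_p^\theta\|f\|_2^{1-\theta}$ for some $0<\theta<1$; this is `IsControlledWeight`.
Young's inequality then makes $\mathcal A$ a convolution algebra and gives $\|f*f\|_{\mathcal A}\le
C'\|f\|_{\mathcal A}^{1+\theta}\|f\|_2^{1-\theta}$: squaring costs only the power $1+\theta<2$ of
the algebra norm, the rest being paid by the $L^2$ norm, which operators on $L^2(G)$ control.

For $b=(f,t)$ the non-discreteness of $G$ gives $|t|\le\|b\|_{op}$, by testing on indicators of
small open sets. Hence the $L^2$ part of $b^2$, namely $b\cdot f+tf$, has norm at most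
$2\|b\|_{op}\|f\|_2$. If $\|b\|_{op}\le\rho<1$, repeated squaring makes the $L^2$ part of $b^{2^k}$
decay like $r^{2^k}$ for any $r\in(\rho,1)$, and the algebra norm is bounded by $r^{2^k}$ times a
factor of size $E^{(1+\theta)^k}$. As $1+\theta<2$, the product tends to zero, at a rate depending
only on $\rho$ and a bound for $\|b\|$ (`exists_forall_le_of_recurrence`).

This suffices for inversion. If $a$ is invertible on $L^2(G)$, then $b=1-N^{-1}a^*a$ has operator
norm bounded away from 1 for a suitable $N$. Some $b^{2^k}$ is small in the algebra, so $1-b^{2^k}$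
is inverted by a Neumann series and $(1-b)^{-1}=(1+b)(1+b^2)\cdots(1-b^{2^k})^{-1}$, with a norm
bound. Finally $a^{-1}=N^{-1}(1-b)^{-1}a^*$ (`admitsNormControlledInversion_of_decay`).

To check the hypotheses, subexponential growth (or a compact exhaustion by subgroups) forces
unimodularity. The interpolation bound, with $\sigma=\omega^\gamma$, is Hölder's inequality with
three factors, and needs $\omega^{-s}$ integrable for some $s/q<1-\gamma$. Here $\gamma=0$ for step
and polynomial weights, and $\gamma=2^\alpha-1$ for $e^{C\tau^\alpha}$. -/

/-! ### Measurability on $G\times G$ without second countability -/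

-- The product $\sigma$-algebra may be smaller than the Borel $\sigma$-algebra of the product, so
-- continuity alone does not give measurability. Compactly supported continuous functions are
-- nevertheless measurable for it, and cutoffs along a compact exhaustion reduce to them.
open Filter in
theorem Continuous.stronglyMeasurable_prod_of_sigmaCompact {X : Type*} [TopologicalSpace X]
    [LocallyCompactSpace X] [T2Space X] [SigmaCompactSpace X] [MeasurableSpace X]
    [OpensMeasurableSpace X] {F : X × X → ℂ} (hF : Continuous F) : StronglyMeasurable F := by
  have hχ : ∀ n, ∃ χ : C(X × X, ℝ), Set.EqOn χ 1 (compactCovering (X × X) n) ∧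
      HasCompactSupport χ := fun n => by
    obtain ⟨χ, h1, -, h3, -⟩ := exists_continuous_one_zero_of_isCompact
      (isCompact_compactCovering (X × X) n) isClosed_empty (Set.disjoint_empty _)
    exact ⟨χ, h1, h3⟩
  choose χ h1 hc using hχ
  refine stronglyMeasurable_of_tendsto atTop (f := fun n z => (χ n z : ℂ) * F z) (fun n => ?_) ?_
  · refine HasCompactSupport.stronglyMeasurable_of_prod
      ((Complex.continuous_ofReal.comp (χ n).continuous).mul hF) ?_
    exact HasCompactSupport.mul_right (f := fun z => (χ n z : ℂ))
      ((hc n).comp_left (g := fun r : ℝ => (r : ℂ)) Complex.ofReal_zero)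
  · rw [tendsto_pi_nhds]
    intro z
    obtain ⟨m, hm⟩ := exists_mem_compactCovering z
    refine tendsto_const_nhds.congr' ?_
    filter_upwards [eventually_ge_atTop m] with n hn
    rw [h1 n (compactCovering_subset _ hn hm)]
    simp


/-! ### Convolution: Tonelli and dependence on representatives -/

section Convolution

variable {G : Type*} [Group G] [MeasurableSpace G]

/-- The convolution `(f ∗ g)(x) = ∫ f(y) g(y⁻¹ x) dy`. -/
noncomputable def groupConv (μ : Measure G) (f g : G → ℂ) (x : G) : ℂ :=
  ∫ y, f y * g (y⁻¹ * x) ∂μ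

/-- Jensen's inequality for the measure $b\,d\mu$, in unnormalised form; it is the pointwise step of
Young's inequality. -/
theorem lintegral_mul_rpow_le {α : Type*} [MeasurableSpace α] {μ : Measure α} {a b : α → ℝ≥0∞}
    (ha : AEMeasurable a μ) (hb : AEMeasurable b μ) {r : ℝ} (hr : 1 ≤ r) :
    (∫⁻ x, a x * b x ∂μ) ^ r ≤ (∫⁻ x, b x ∂μ) ^ (r - 1) * ∫⁻ x, a x ^ r * b x ∂μ := by
  have hr0 : 0 < r := by linarith
  have h := ENNReal.lintegral_mul_norm_pow_le (μ := μ) ((ha.pow_const r).mul hb) hb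
    (p := 1 / r) (q := 1 - 1 / r) (by positivity)
    (by rw [sub_nonneg, div_le_one hr0]; exact hr) (by ring)
  have e : ∀ x, (a x ^ r * b x) ^ (1 / r) * b x ^ (1 - 1 / r) = a x * b x := fun x => by
    rw [ENNReal.mul_rpow_of_nonneg _ _ (by positivity), ← ENNReal.rpow_mul, mul_assoc,
      ← ENNReal.rpow_add_of_nonneg _ _ (by positivity)
        (by rw [sub_nonneg, div_le_one hr0]; exact hr)]
    simp [hr0.ne']
  simp only [Pi.mul_apply, e] at h
  calc _ ≤ _ := ENNReal.rpow_le_rpow h hr0.le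
    _ = _ := by
      rw [ENNReal.mul_rpow_of_nonneg _ _ hr0.le, ← ENNReal.rpow_mul, ← ENNReal.rpow_mul, mul_comm]
      congr 2
      · field_simp
      · rw [one_div, inv_mul_cancel₀ hr0.ne', ENNReal.rpow_one]

variable {μ : Measure G} [μ.IsMulLeftInvariant] [MeasurableMul G]

theorem lintegral_lintegral_inv_mul [SFinite μ] {F K : G → ℝ≥0∞} (hF : Measurable F)
    (hK : Measurable fun z : G × G => K (z.1⁻¹ * z.2)) :
    ∫⁻ x, ∫⁻ y, F y * K (y⁻¹ * x) ∂μ ∂μ = (∫⁻ x, F x ∂μ) * ∫⁻ x, K x ∂μ := by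
  rw [lintegral_lintegral_swap]
  · have : ∀ y, ∫⁻ x, F y * K (y⁻¹ * x) ∂μ = F y * ∫⁻ x, K x ∂μ := fun y => by
      rw [lintegral_const_mul, lintegral_mul_left_eq_self]
      exact hK.comp (measurable_const.prodMk measurable_id)
    simp only [this]
    rw [lintegral_mul_const _ hF]
  · exact ((hF.comp measurable_snd).mul (hK.comp measurable_swap)).aemeasurable

variable [MeasurableInv G] [μ.IsInvInvariant]

/-- Unimodularity enters here: it makes $f*g$ defined at every point for $f,g\in L^2$ and
insensitive to changes on null sets. -/
theorem measurePreserving_inv_mul_right (x : G) :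
    MeasurePreserving (fun y => y⁻¹ * x) μ μ := by
  have h := (Measure.measurePreserving_inv μ).comp (measurePreserving_mul_left μ x⁻¹)
  simpa [Function.comp_def] using h

theorem groupConv_congr {f f' g g' : G → ℂ} (hf : f =ᵐ[μ] f') (hg : g =ᵐ[μ] g') :
    groupConv μ f g = groupConv μ f' g' := by
  funext x
  refine integral_congr_ae ?_
  filter_upwards [hf, (measurePreserving_inv_mul_right (μ := μ) x).quasiMeasurePreserving.ae_eq_comp
    hg] with y h1 h2
  simp only [Function.comp_apply] at h2
  rw [h1, h2]

theorem integrable_groupConv {f g : G → ℂ} (hf : MemLp f 2 μ) (hg : MemLp g 2 μ) (x : G) :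
    Integrable (fun y => f y * g (y⁻¹ * x)) μ :=
  hf.integrable_mul (hg.comp_measurePreserving (measurePreserving_inv_mul_right x))

end Convolution

/-! ### Representatives $f'$ with $(x,y)\mapsto f'(x^{-1}y)$ measurable -/

section Representatives

variable {G : Type*} [Group G] [TopologicalSpace G] [IsTopologicalGroup G] [LocallyCompactSpace G]
  [T2Space G] [SigmaCompactSpace G] [MeasurableSpace G] [BorelSpace G]

variable (G) in
/-- The largest sub-`σ`-algebra of the Borel `σ`-algebra of `G` for which `(x, y) ↦ x⁻¹ y` is
measurable on `G × G` with the product `σ`-algebra. -/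
@[reducible]
def invMulMeasurableSpace : MeasurableSpace G :=
  ‹MeasurableSpace G› ⊓ MeasurableSpace.map (fun z : G × G => z.1⁻¹ * z.2) inferInstance

theorem invMulMeasurableSpace_le : invMulMeasurableSpace G ≤ ‹MeasurableSpace G› := inf_le_left

theorem Continuous.measurable_invMulMeasurableSpace {g : G → ℂ} (hg : Continuous g) :
    Measurable[invMulMeasurableSpace G] g := by
  intro s hs
  refine ⟨hg.measurable hs, ?_⟩
  have : StronglyMeasurable fun z : G × G => g (z.1⁻¹ * z.2) :=
    Continuous.stronglyMeasurable_prod_of_sigmaCompact (by fun_prop)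
  exact this.measurable hs

variable {μ : Measure G} [μ.IsHaarMeasure] [μ.Regular]

/-- The classes measurable for `invMulMeasurableSpace` form a closed subset of $L^p$ containing the
dense set of compactly supported continuous functions. Such representatives make Fubini available on
groups that are not second countable. -/
theorem MeasureTheory.MemLp.exists_measurable_inv_mul {p : ℝ≥0∞} (hp1 : 1 ≤ p) (hp : p ≠ ∞)
    {f : G → ℂ} (hf : MemLp f p μ) :
    ∃ f' : G → ℂ, Measurable f' ∧ Measurable (fun z : G × G => f' (z.1⁻¹ * z.2)) ∧
      f =ᵐ[μ] f' := by
  have : Fact (1 ≤ p) := ⟨hp1⟩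
  have hcl := isClosed_aestronglyMeasurable (F := ℂ) (p := p) (μ := μ)
    (invMulMeasurableSpace_le (G := G))
  have hmem : hf.toLp f ∈ {f : Lp ℂ p μ | AEStronglyMeasurable[invMulMeasurableSpace G] f μ} := by
    rw [← hcl.closure_eq, EMetric.mem_closure_iff]
    intro ε hε
    obtain ⟨δ, hδ0, hδ⟩ := exists_between hε
    obtain ⟨g, -, hg, hgc, hgm⟩ := hf.exists_hasCompactSupport_eLpNorm_sub_le hp hδ0.ne'
    refine ⟨hgm.toLp g, ?_, ?_⟩
    · refine ⟨g, ?_, hgm.coeFn_toLp⟩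
      exact hgc.measurable_invMulMeasurableSpace.stronglyMeasurable
    · rw [Lp.edist_toLp_toLp]
      exact hg.trans_lt hδ
  obtain ⟨f', hf', he⟩ := hmem
  have hm := hf'.measurable
  refine ⟨f', fun s hs => (hm hs).1, fun s hs => (hm hs).2, hf.coeFn_toLp.symm.trans he⟩

end Representatives

/-! ### Young's inequality, associativity and adjoints -/

section Young

variable {G : Type*} [Group G] [MeasurableSpace G]

/-- The convolution `|f| ∗ |g|`, with values in `[0, ∞]`. -/
noncomputable def groupLConv (μ : Measure G) (f g : G → ℂ) (x : G) : ℝ≥0∞ :=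
  ∫⁻ y, ‖f y‖ₑ * ‖g (y⁻¹ * x)‖ₑ ∂μ

theorem enorm_groupConv_le (μ : Measure G) (f g : G → ℂ) (x : G) :
    ‖groupConv μ f g x‖ₑ ≤ groupLConv μ f g x := by
  refine (enorm_integral_le_lintegral_enorm _).trans_eq ?_
  simp only [enorm_mul, groupLConv]

variable [TopologicalSpace G] [IsTopologicalGroup G] [BorelSpace G] {μ : Measure G}
  [μ.IsHaarMeasure] [μ.IsInvInvariant]

theorem groupLConv_congr {f f' g g' : G → ℂ} (hf : f =ᵐ[μ] f') (hg : g =ᵐ[μ] g') :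
    groupLConv μ f g = groupLConv μ f' g' := by
  funext x
  refine lintegral_congr_ae ?_
  filter_upwards [hf, (measurePreserving_inv_mul_right (μ := μ) x).quasiMeasurePreserving.ae_eq_comp
    hg] with y h1 h2
  simp only [Function.comp_apply] at h2
  rw [h1, h2]

variable [LocallyCompactSpace G] [T2Space G] [SigmaCompactSpace G] [μ.Regular]
  {p q : ℝ≥0∞} {f g k : G → ℂ}

theorem measurable_groupLConv (hp1 : 1 ≤ p) (hp : p ≠ ∞) (hf : AEStronglyMeasurable f μ)
    (hg : MemLp g p μ) : Measurable (groupLConv μ f g) := by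
  obtain ⟨g', -, hg', e⟩ := hg.exists_measurable_inv_mul hp1 hp
  rw [groupLConv_congr hf.ae_eq_mk e]
  refine Measurable.lintegral_prod_right'
    (f := fun z : G × G => ‖hf.mk f z.2‖ₑ * ‖g' (z.2⁻¹ * z.1)‖ₑ) ?_
  exact (hf.measurable_mk.enorm.comp measurable_snd).mul (hg'.enorm.comp measurable_swap)

theorem stronglyMeasurable_groupConv (hp1 : 1 ≤ p) (hp : p ≠ ∞) (hf : AEStronglyMeasurable f μ)
    (hg : MemLp g p μ) : StronglyMeasurable (groupConv μ f g) := by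
  obtain ⟨g', -, hg', e⟩ := hg.exists_measurable_inv_mul hp1 hp
  rw [groupConv_congr hf.ae_eq_mk e]
  refine StronglyMeasurable.integral_prod_right
    (f := fun x y => hf.mk f y * g' (y⁻¹ * x)) ?_
  exact ((hf.measurable_mk.comp measurable_snd).mul (hg'.comp measurable_swap)).stronglyMeasurable

/-- Young's inequality `‖f ∗ g‖_p ≤ ‖f‖_1 ‖g‖_p`. -/
theorem eLpNorm_groupLConv_le_left (hp1 : 1 ≤ p) (hp : p ≠ ∞) (hf : MemLp f 1 μ)
    (hg : MemLp g p μ) : eLpNorm (groupLConv μ f g) p μ ≤ eLpNorm f 1 μ * eLpNorm g p μ := by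
  obtain ⟨f', hfm, -, ef⟩ := hf.exists_measurable_inv_mul le_rfl ENNReal.one_ne_top
  obtain ⟨g', hgm, hg', eg⟩ := hg.exists_measurable_inv_mul hp1 hp
  rw [groupLConv_congr ef eg, eLpNorm_congr_ae ef, eLpNorm_congr_ae eg]
  have hp0 : p ≠ 0 := (zero_lt_one.trans_le hp1).ne'
  have hr1 : 1 ≤ p.toReal := by simpa using ENNReal.toReal_mono hp hp1
  have hr0 : 0 < p.toReal := by linarith
  have hgx : ∀ x, Measurable fun y => ‖g' (y⁻¹ * x)‖ₑ := fun x =>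
    hgm.enorm.comp (by fun_prop)
  have key : ∫⁻ x, groupLConv μ f' g' x ^ p.toReal ∂μ ≤
      (∫⁻ y, ‖f' y‖ₑ ∂μ) ^ p.toReal * ∫⁻ y, ‖g' y‖ₑ ^ p.toReal ∂μ := by
    calc ∫⁻ x, groupLConv μ f' g' x ^ p.toReal ∂μ
        ≤ ∫⁻ x, (∫⁻ y, ‖f' y‖ₑ ∂μ) ^ (p.toReal - 1) *
            ∫⁻ y, ‖f' y‖ₑ * ‖g' (y⁻¹ * x)‖ₑ ^ p.toReal ∂μ ∂μ := by
          refine lintegral_mono fun x => ?_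
          have := lintegral_mul_rpow_le (hgx x).aemeasurable hfm.enorm.aemeasurable (μ := μ) hr1
          simpa only [groupLConv, mul_comm] using this
      _ = (∫⁻ y, ‖f' y‖ₑ ∂μ) ^ (p.toReal - 1) *
            ((∫⁻ y, ‖f' y‖ₑ ∂μ) * ∫⁻ y, ‖g' y‖ₑ ^ p.toReal ∂μ) := by
          rw [lintegral_const_mul', lintegral_lintegral_inv_mul hfm.enorm
            (K := fun x => ‖g' x‖ₑ ^ p.toReal) (hg'.enorm.pow_const _)]
          refine ENNReal.rpow_ne_top_of_nonneg (by linarith) ?_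
          rw [← eLpNorm_one_eq_lintegral_enorm, ← eLpNorm_congr_ae ef]
          exact hf.2.ne
      _ = _ := by
          rw [← mul_assoc]
          congr 1
          nth_rewrite 2 [← ENNReal.rpow_one (∫⁻ y, ‖f' y‖ₑ ∂μ)]
          rw [← ENNReal.rpow_add_of_nonneg _ _ (by linarith) zero_le_one, sub_add_cancel]
  rw [eLpNorm_eq_lintegral_rpow_enorm_toReal hp0 hp, eLpNorm_eq_lintegral_rpow_enorm_toReal hp0 hp,
    eLpNorm_one_eq_lintegral_enorm]
  simp only [enorm_eq_self]
  calc _ ≤ _ := ENNReal.rpow_le_rpow key (by positivity)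
    _ = _ := by
      rw [ENNReal.mul_rpow_of_nonneg _ _ (by positivity), ← ENNReal.rpow_mul,
        mul_one_div_cancel hr0.ne', ENNReal.rpow_one]

/-- Young's inequality `‖f ∗ g‖_p ≤ ‖f‖_p ‖g‖_1`. -/
theorem eLpNorm_groupLConv_le_right (hp1 : 1 ≤ p) (hp : p ≠ ∞) (hf : MemLp f p μ)
    (hg : MemLp g 1 μ) : eLpNorm (groupLConv μ f g) p μ ≤ eLpNorm f p μ * eLpNorm g 1 μ := by
  obtain ⟨f', hfm, -, ef⟩ := hf.exists_measurable_inv_mul hp1 hp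
  obtain ⟨g', hgm, hg', eg⟩ := hg.exists_measurable_inv_mul le_rfl ENNReal.one_ne_top
  rw [groupLConv_congr ef eg, eLpNorm_congr_ae ef, eLpNorm_congr_ae eg]
  have hp0 : p ≠ 0 := (zero_lt_one.trans_le hp1).ne'
  have hr1 : 1 ≤ p.toReal := by simpa using ENNReal.toReal_mono hp hp1
  have hr0 : 0 < p.toReal := by linarith
  have hgx : ∀ x, Measurable fun y => ‖g' (y⁻¹ * x)‖ₑ := fun x =>
    hgm.enorm.comp (by fun_prop)
  have hgi : ∀ x, ∫⁻ y, ‖g' (y⁻¹ * x)‖ₑ ∂μ = ∫⁻ y, ‖g' y‖ₑ ∂μ := fun x =>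
    (measurePreserving_inv_mul_right (μ := μ) x).lintegral_comp hgm.enorm
  have key : ∫⁻ x, groupLConv μ f' g' x ^ p.toReal ∂μ ≤
      (∫⁻ y, ‖f' y‖ₑ ^ p.toReal ∂μ) * (∫⁻ y, ‖g' y‖ₑ ∂μ) ^ p.toReal := by
    calc ∫⁻ x, groupLConv μ f' g' x ^ p.toReal ∂μ
        ≤ ∫⁻ x, (∫⁻ y, ‖g' y‖ₑ ∂μ) ^ (p.toReal - 1) *
            ∫⁻ y, ‖f' y‖ₑ ^ p.toReal * ‖g' (y⁻¹ * x)‖ₑ ∂μ ∂μ := by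
          refine lintegral_mono fun x => ?_
          have := lintegral_mul_rpow_le hfm.enorm.aemeasurable (hgx x).aemeasurable (μ := μ) hr1
          rwa [hgi] at this
      _ = (∫⁻ y, ‖g' y‖ₑ ∂μ) ^ (p.toReal - 1) *
            ((∫⁻ y, ‖f' y‖ₑ ^ p.toReal ∂μ) * ∫⁻ y, ‖g' y‖ₑ ∂μ) := by
          rw [lintegral_const_mul', lintegral_lintegral_inv_mul (hfm.enorm.pow_const _)
            (K := fun x => ‖g' x‖ₑ) hg'.enorm]
          refine ENNReal.rpow_ne_top_of_nonneg (by linarith) ?_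
          rw [← eLpNorm_one_eq_lintegral_enorm, ← eLpNorm_congr_ae eg]
          exact hg.2.ne
      _ = _ := by
          rw [mul_left_comm]
          congr 1
          nth_rewrite 2 [← ENNReal.rpow_one (∫⁻ y, ‖g' y‖ₑ ∂μ)]
          rw [← ENNReal.rpow_add_of_nonneg _ _ (by linarith) zero_le_one, sub_add_cancel]
  rw [eLpNorm_eq_lintegral_rpow_enorm_toReal hp0 hp, eLpNorm_eq_lintegral_rpow_enorm_toReal hp0 hp,
    eLpNorm_one_eq_lintegral_enorm]
  simp only [enorm_eq_self]
  calc _ ≤ _ := ENNReal.rpow_le_rpow key (by positivity)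
    _ = _ := by
      rw [ENNReal.mul_rpow_of_nonneg _ _ (by positivity), ← ENNReal.rpow_mul _ p.toReal,
        mul_one_div_cancel hr0.ne', ENNReal.rpow_one]

theorem eLpNorm_groupConv_le_left (hp1 : 1 ≤ p) (hp : p ≠ ∞) (hf : MemLp f 1 μ)
    (hg : MemLp g p μ) : eLpNorm (groupConv μ f g) p μ ≤ eLpNorm f 1 μ * eLpNorm g p μ :=
  (eLpNorm_mono_enorm fun x => (enorm_groupConv_le μ f g x).trans_eq (enorm_eq_self _).symm).trans
    (eLpNorm_groupLConv_le_left hp1 hp hf hg)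

theorem eLpNorm_groupConv_le_right (hp1 : 1 ≤ p) (hp : p ≠ ∞) (hf : MemLp f p μ)
    (hg : MemLp g 1 μ) : eLpNorm (groupConv μ f g) p μ ≤ eLpNorm f p μ * eLpNorm g 1 μ :=
  (eLpNorm_mono_enorm fun x => (enorm_groupConv_le μ f g x).trans_eq (enorm_eq_self _).symm).trans
    (eLpNorm_groupLConv_le_right hp1 hp hf hg)

theorem memLp_groupConv (hp1 : 1 ≤ p) (hp : p ≠ ∞) (hf : MemLp f 1 μ)
    (hg : MemLp g p μ) : MemLp (groupConv μ f g) p μ :=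
  ⟨(stronglyMeasurable_groupConv hp1 hp hf.1 hg).aestronglyMeasurable,
    (eLpNorm_groupConv_le_left hp1 hp hf hg).trans_lt (ENNReal.mul_lt_top hf.2 hg.2)⟩

/-- Fubini, the double integral being dominated by $\|f\|_1\|g\|_2\|k\|_2$. Both associativity and
the adjoint formula are read off from it. -/
theorem integral_groupConv_mul (hf : MemLp f 1 μ) (hg : MemLp g 2 μ) (hk : MemLp k 2 μ) :
    ∫ z, groupConv μ f g z * k z ∂μ = ∫ y, f y * ∫ z, g (y⁻¹ * z) * k z ∂μ ∂μ := by
  obtain ⟨f', hfm, -, ef⟩ := hf.exists_measurable_inv_mul le_rfl ENNReal.one_ne_top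
  obtain ⟨g', hgm, hg', eg⟩ := hg.exists_measurable_inv_mul one_le_two ENNReal.ofNat_ne_top
  obtain ⟨k', hkm, -, ek⟩ := hk.exists_measurable_inv_mul one_le_two ENNReal.ofNat_ne_top
  replace hf := (memLp_congr_ae ef).1 hf
  replace hg := (memLp_congr_ae eg).1 hg
  replace hk := (memLp_congr_ae ek).1 hk
  have e1 : ∫ z, groupConv μ f g z * k z ∂μ = ∫ z, groupConv μ f' g' z * k' z ∂μ := by
    rw [groupConv_congr ef eg]
    refine integral_congr_ae ?_
    filter_upwards [ek] with z hz
    rw [hz]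
  have e2 : ∫ y, f y * ∫ z, g (y⁻¹ * z) * k z ∂μ ∂μ =
      ∫ y, f' y * ∫ z, g' (y⁻¹ * z) * k' z ∂μ ∂μ := by
    refine integral_congr_ae ?_
    filter_upwards [ef] with y hy
    rw [hy]
    congr 1
    refine integral_congr_ae ?_
    filter_upwards [ek,
      (measurePreserving_mul_left μ y⁻¹).quasiMeasurePreserving.ae_eq_comp eg] with z hz h2
    simp only [Function.comp_apply] at h2
    rw [hz, h2]
  rw [e1, e2]
  have hm : Measurable fun z : G × G => f' z.1 * (g' (z.1⁻¹ * z.2) * k' z.2) := by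
    exact (hfm.comp measurable_fst).mul (hg'.mul (hkm.comp measurable_snd))
  have hint : Integrable (fun z : G × G => f' z.1 * (g' (z.1⁻¹ * z.2) * k' z.2)) (μ.prod μ) := by
    refine ⟨hm.aestronglyMeasurable, ?_⟩
    rw [hasFiniteIntegral_iff_enorm, lintegral_prod _ hm.enorm.aemeasurable]
    calc ∫⁻ y, ∫⁻ z, ‖f' y * (g' (y⁻¹ * z) * k' z)‖ₑ ∂μ ∂μ
        ≤ ∫⁻ y, ‖f' y‖ₑ * (eLpNorm g' 2 μ * eLpNorm k' 2 μ) ∂μ := by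
          refine lintegral_mono fun y => ?_
          simp only [enorm_mul]
          rw [lintegral_const_mul' _ _ enorm_ne_top]
          gcongr
          have h := eLpNorm_smul_le_mul_eLpNorm (p := 2) (q := 2) (r := 1) (μ := μ)
            (φ := fun z => g' (y⁻¹ * z)) hk.1 (hg.1.comp_measurePreserving
              (measurePreserving_mul_left μ y⁻¹))
          rw [eLpNorm_one_eq_lintegral_enorm] at h
          have h3 : eLpNorm (fun z => g' (y⁻¹ * z)) 2 μ = eLpNorm g' 2 μ :=
            eLpNorm_comp_measurePreserving hg.1 (measurePreserving_mul_left μ y⁻¹)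
          rw [h3] at h
          simpa [enorm_mul] using h
      _ < ∞ := by
          rw [lintegral_mul_const _ hfm.enorm, ← eLpNorm_one_eq_lintegral_enorm]
          exact ENNReal.mul_lt_top hf.2 (ENNReal.mul_lt_top hg.2 hk.2)
  calc ∫ z, groupConv μ f' g' z * k' z ∂μ
      = ∫ z, ∫ y, f' y * (g' (y⁻¹ * z) * k' z) ∂μ ∂μ := by
        refine integral_congr_ae (Filter.Eventually.of_forall fun z => ?_)
        simp only [groupConv]
        rw [← integral_mul_const]
        simp only [mul_assoc]
    _ = ∫ y, ∫ z, f' y * (g' (y⁻¹ * z) * k' z) ∂μ ∂μ :=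
        (integral_integral_swap (f := fun y z => f' y * (g' (y⁻¹ * z) * k' z)) hint).symm
    _ = _ := by simp only [integral_const_mul]

theorem groupConv_assoc (hf : MemLp f 1 μ) (hg : MemLp g 2 μ) (hk : MemLp k 2 μ) :
    groupConv μ (groupConv μ f g) k = groupConv μ f (groupConv μ g k) := by
  funext x
  have h := integral_groupConv_mul hf hg
    (hk.comp_measurePreserving (measurePreserving_inv_mul_right x))
  simp only [Function.comp_apply] at h
  rw [groupConv, h, groupConv]
  refine integral_congr_ae (Filter.Eventually.of_forall fun y => ?_)
  simp only [groupConv]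
  rw [← integral_mul_left_eq_self _ y]
  simp [mul_assoc]

/-- The transpose of convolution by $f$ is convolution by $y\mapsto f(y^{-1})$: both sides become
the same double integral after $y\mapsto y^{-1}$ and a left translation of the inner variable. -/
theorem integral_groupConv_mul_eq_inv (hf : MemLp f 1 μ) (hg : MemLp g 2 μ) (hk : MemLp k 2 μ) :
    ∫ z, groupConv μ f g z * k z ∂μ = ∫ z, g z * groupConv μ (fun y => f y⁻¹) k z ∂μ := by
  have hf' : MemLp (fun y => f y⁻¹) 1 μ :=
    hf.comp_measurePreserving (Measure.measurePreserving_inv μ)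
  simp_rw [mul_comm (g _)]
  rw [integral_groupConv_mul hf hg hk, integral_groupConv_mul hf' hk hg,
    ← integral_inv_eq_self]
  refine integral_congr_ae (Filter.Eventually.of_forall fun y => ?_)
  simp only [inv_inv]
  congr 1
  rw [← integral_mul_left_eq_self _ y⁻¹]
  simp [mul_comm]

theorem groupConv_add_left {f₁ f₂ : G → ℂ} (h₁ : MemLp f₁ 2 μ) (h₂ : MemLp f₂ 2 μ)
    (hg : MemLp g 2 μ) : groupConv μ (f₁ + f₂) g = groupConv μ f₁ g + groupConv μ f₂ g := by
  funext x
  simp only [groupConv, Pi.add_apply, add_mul]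
  exact integral_add (integrable_groupConv h₁ hg x) (integrable_groupConv h₂ hg x)

theorem groupConv_add_right {g₁ g₂ : G → ℂ} (hf : MemLp f 2 μ) (h₁ : MemLp g₁ 2 μ)
    (h₂ : MemLp g₂ 2 μ) : groupConv μ f (g₁ + g₂) = groupConv μ f g₁ + groupConv μ f g₂ := by
  funext x
  simp only [groupConv, Pi.add_apply, mul_add]
  exact integral_add (integrable_groupConv hf h₁ x) (integrable_groupConv hf h₂ x)

end Young

theorem groupConv_smul_left {G : Type*} [Group G] [MeasurableSpace G] (μ : Measure G) (c : ℂ)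
    (f g : G → ℂ) : groupConv μ (c • f) g = c • groupConv μ f g := by
  funext x
  simp only [groupConv, Pi.smul_apply, smul_eq_mul, mul_assoc, integral_const_mul]

theorem groupConv_smul_right {G : Type*} [Group G] [MeasurableSpace G] (μ : Measure G) (c : ℂ)
    (f g : G → ℂ) : groupConv μ f (c • g) = c • groupConv μ f g := by
  funext x
  simp only [groupConv, Pi.smul_apply, smul_eq_mul, mul_left_comm, integral_const_mul]

/-! ### The scalar recurrence behind the decay of repeated squares -/

section Decay

open Filter Real

/-- The factor $2^k$ is absorbed by enlarging $\rho$ to $r$, since $j(\rho/r)^j$ is bounded. -/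
theorem exists_mul_pow_le {ρ r : ℝ} (hρ : 0 < ρ) (hr : ρ < r) :
    ∃ W : ℝ, 0 ≤ W ∧ ∀ k : ℕ, (2 : ℝ) ^ k * ρ ^ 2 ^ k ≤ W * r ^ 2 ^ k := by
  have hr0 : 0 < r := hρ.trans hr
  have hq : ρ / r < 1 := (div_lt_one hr0).2 hr
  obtain ⟨W, hW⟩ := (tendsto_self_mul_const_pow_of_lt_one (by positivity) hq).bddAbove_range
  refine ⟨max W 0, le_max_right _ _, fun k => ?_⟩
  have h : ((2 ^ k : ℕ) : ℝ) * (ρ / r) ^ 2 ^ k ≤ W := hW ⟨2 ^ k, rfl⟩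
  rw [div_pow, ← mul_div_assoc, div_le_iff₀ (by positivity)] at h
  push_cast at h
  exact h.trans (by gcongr; exact le_max_left _ _)

/-- The logarithm is $2^k(\log r+((1+\theta)/2)^k\log E)$, whose bracket tends to $\log r<0$ because
$1+\theta<2$. -/
theorem tendsto_pow_two_pow_mul_rpow {r E θ : ℝ} (hr0 : 0 < r) (hr1 : r < 1) (hE : 0 < E)
    (hθ0 : 0 < θ) (hθ1 : θ < 1) :
    Tendsto (fun k : ℕ => r ^ 2 ^ k * E ^ ((1 + θ) ^ k)) atTop (𝓝 0) := by
  have h1 : Tendsto (fun k : ℕ => Real.log r + ((1 + θ) / 2) ^ k * Real.log E) atTop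
      (𝓝 (Real.log r + 0 * Real.log E)) :=
    tendsto_const_nhds.add ((tendsto_pow_atTop_nhds_zero_of_lt_one (by linarith)
      (by linarith)).mul_const _)
  have h2 : Tendsto (fun k : ℕ => (2 : ℝ) ^ k * (Real.log r + ((1 + θ) / 2) ^ k * Real.log E))
      atTop atBot :=
    (tendsto_pow_atTop_atTop_of_one_lt one_lt_two).atTop_mul_neg
      (by simpa using Real.log_neg hr0 hr1) h1
  refine (Real.tendsto_exp_atBot.comp h2).congr fun k => ?_
  have e : (2 : ℝ) ^ k * (Real.log r + ((1 + θ) / 2) ^ k * Real.log E) =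
      ((2 ^ k : ℕ) : ℝ) * Real.log r + Real.log E * (1 + θ) ^ k := by
    push_cast
    rw [div_pow]
    field_simp
  rw [Function.comp_apply, e, Real.exp_add, Real.exp_nat_mul, Real.exp_log hr0,
    Real.rpow_def_of_pos hE]

/-- In the application $x_k$ is the algebra norm of $b^{2^k}$ and $n_k$ the $L^2$ norm of its
function part. The proof shows $n_k\le W r^{2^k}$ and $x_k\le r^{2^k}Z_k$ with $Z_k$ of size
$E^{(1+\theta)^k}$. The index is chosen before the sequences, which is the uniformity that norm
control requires. -/
theorem exists_forall_le_of_recurrence {C θ M ρ ε : ℝ} (hC : 0 ≤ C) (hθ0 : 0 < θ) (hθ1 : θ < 1)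
    (hM : 0 ≤ M) (hρ0 : 0 < ρ) (hρ1 : ρ < 1) (hε : 0 < ε) :
    ∃ k : ℕ, ∀ x n : ℕ → ℝ, (∀ k, 0 ≤ x k) → (∀ k, 0 ≤ n k) → x 0 ≤ M → n 0 ≤ M →
      (∀ k, n (k + 1) ≤ 2 * ρ ^ 2 ^ k * n k) →
      (∀ k, x (k + 1) ≤ C * x k ^ (1 + θ) * n k ^ (1 - θ) + 2 * ρ ^ 2 ^ k * x k) → x k ≤ ε := by
  obtain ⟨r, hρr, hr1⟩ := exists_between hρ1
  have hr0 : 0 < r := hρ0.trans hρr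
  obtain ⟨V, hV0, hV⟩ := exists_mul_pow_le hρ0 hρr
  set W := M / ρ * V with hW
  have hW0 : 0 ≤ W := by positivity
  -- After division by $r^{2^{k+1}}$ the recurrence reads $Z_{k+1}=DZ_k^{1+\theta}$, the summand 2
  -- taking care of the linear term because $Z_k\ge1$. Here $F$ solves $DF^{1+\theta}=F$, and $E$ is
  -- fixed by $Z_0=\max(1,M/r)$.
  set D := C * W ^ (1 - θ) + 2 with hD
  have hD0 : 0 < D := by positivity
  set F := D ^ (-(1 / θ)) with hF
  set E := D ^ (1 / θ) * max 1 (M / r) with hE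
  have hE0 : 0 < E := by positivity
  have hF0 : 0 < F := by positivity
  have hFD : F * D ^ (1 / θ) = 1 := by rw [hF, ← Real.rpow_add hD0]; simp
  have hD1 : 1 ≤ D ^ (1 / θ) := Real.one_le_rpow
    (by rw [hD]; linarith [show 0 ≤ C * W ^ (1 - θ) by positivity]) (by positivity)
  have hE1 : 1 ≤ E := by
    rw [hE]; exact one_le_mul_of_one_le_of_one_le hD1 (le_max_left _ _)
  set Z : ℕ → ℝ := fun k => F * E ^ ((1 + θ) ^ k) with hZ
  have hZ1 : ∀ k, 1 ≤ Z k := fun k => by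
    have : D ^ (1 / θ) ≤ E ^ ((1 + θ) ^ k) := by
      calc D ^ (1 / θ) ≤ E := le_mul_of_one_le_right (by positivity) (le_max_left _ _)
        _ = E ^ (1 : ℝ) := (Real.rpow_one _).symm
        _ ≤ _ := Real.rpow_le_rpow_of_exponent_le hE1 (one_le_pow₀ (by linarith))
    calc 1 = F * D ^ (1 / θ) := hFD.symm
      _ ≤ _ := by simp only [hZ]; gcongr
  have hZs : ∀ k, D * Z k ^ (1 + θ) = Z (k + 1) := fun k => by
    simp only [hZ]
    rw [Real.mul_rpow hF0.le (by positivity), ← Real.rpow_mul hE0.le, ← pow_succ, ← mul_assoc]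
    congr 1
    rw [hF, ← Real.rpow_mul hD0.le]
    nth_rewrite 1 [← Real.rpow_one D]
    rw [← Real.rpow_add hD0]
    congr 1
    field_simp
    ring
  have hlim : Tendsto (fun k : ℕ => r ^ 2 ^ k * Z k) atTop (𝓝 0) := by
    have := (tendsto_pow_two_pow_mul_rpow hr0 hr1 hE0 hθ0 hθ1).const_mul F
    rw [mul_zero] at this
    refine this.congr fun k => ?_
    simp only [hZ]
    ring
  obtain ⟨k, hk⟩ := (hlim.eventually (gt_mem_nhds hε)).exists
  refine ⟨k, fun x n hx hn hx0 hn0 hns hxs => le_trans ?_ hk.le⟩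
  have hnW : ∀ j, n j ≤ W * r ^ 2 ^ j := fun j => by
    -- The exponents $1+2+\dots+2^{j-1}$ add up to $2^j-1$; the extra factor $\rho$ completes the
    -- power.
    have h1 : ρ * n j ≤ 2 ^ j * ρ ^ 2 ^ j * M := by
      induction j with
      | zero => simpa using mul_le_mul_of_nonneg_left hn0 hρ0.le
      | succ j ih =>
        calc ρ * n (j + 1) ≤ ρ * (2 * ρ ^ 2 ^ j * n j) := by gcongr; exact hns j
          _ = 2 * ρ ^ 2 ^ j * (ρ * n j) := by ring
          _ ≤ 2 * ρ ^ 2 ^ j * (2 ^ j * ρ ^ 2 ^ j * M) := by gcongr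
          _ = _ := by rw [pow_succ (2 : ℝ) j, pow_succ 2 j, pow_mul]; ring
    have h2 : ρ * n j ≤ V * r ^ 2 ^ j * M := h1.trans
      (mul_le_mul_of_nonneg_right (hV j) hM)
    rw [hW, ← mul_le_mul_iff_right₀ hρ0]
    refine h2.trans_eq ?_
    field_simp
  clear hk
  induction k with
  | zero =>
    refine hx0.trans ?_
    have : Z 0 = max 1 (M / r) := by
      simp only [hZ, pow_zero, Real.rpow_one]
      rw [hE, ← mul_assoc, hFD, one_mul]
    rw [this, pow_zero, pow_one, ← div_le_iff₀' hr0]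
    exact le_max_right _ _
  | succ k ih =>
    have hZ0 : 0 < Z k := zero_lt_one.trans_le (hZ1 k)
    have hR : 0 < r ^ 2 ^ k := by positivity
    set R := r ^ 2 ^ k with hRdef
    calc x (k + 1) ≤ C * x k ^ (1 + θ) * n k ^ (1 - θ) + 2 * ρ ^ 2 ^ k * x k := hxs k
      _ ≤ C * (R * Z k) ^ (1 + θ) * (W * R) ^ (1 - θ) + 2 * R * (R * Z k) := by
        have := hx k
        have := hn k
        have h3 : 0 ≤ 1 - θ := by linarith
        have h4 : ρ ^ 2 ^ k ≤ R := pow_le_pow_left₀ hρ0.le hρr.le _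
        gcongr
        exact hnW k
      _ = R ^ 2 * (C * W ^ (1 - θ) * Z k ^ (1 + θ) + 2 * Z k) := by
        rw [Real.mul_rpow hR.le hZ0.le, Real.mul_rpow hW0 hR.le]
        have : R ^ (1 + θ) * R ^ (1 - θ) = R ^ 2 := by
          rw [← Real.rpow_add hR, ← Real.rpow_natCast]; congr 1; push_cast; ring
        rw [← this]
        have : R ^ (1 + θ) * R ^ (1 - θ) = R * R := by rw [this]; ring
        linear_combination (-2 * Z k) * this
      _ ≤ R ^ 2 * (D * Z k ^ (1 + θ)) := by
        gcongr
        rw [hD, add_mul]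
        gcongr
        calc Z k = Z k ^ (1 : ℝ) := (Real.rpow_one _).symm
          _ ≤ _ := Real.rpow_le_rpow_of_exponent_le (hZ1 k) (by linarith)
      _ = _ := by rw [hZs, hRdef, ← pow_mul, pow_succ]

end Decay

/-! ### A contraction built from an invertible operator -/

section Hilbert

open ContinuousLinearMap

variable {H : Type*} [NormedAddCommGroup H] [InnerProductSpace ℂ H] [CompleteSpace H]

/-- Expand $\|g-N^{-1}A^*Ag\|^2$. As $\|A^*Ag\|^2\le N\|Ag\|^2$, it is at most
$\|g\|^2-N^{-1}\|Ag\|^2$, and the left inverse gives $\|Ag\|\ge\|g\|/m$. -/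
theorem norm_one_sub_smul_adjoint_mul_le {A B : H →L[ℂ] H} (hBA : B * A = 1) {N m : ℝ}
    (hN0 : 0 < N) (hN : ‖A‖ ^ 2 ≤ N) (hm0 : 0 < m) (hm : ‖B‖ ≤ m) :
    ‖1 - ((N⁻¹ : ℝ) : ℂ) • (adjoint A * A)‖ ≤ Real.sqrt (1 - N⁻¹ / m ^ 2) := by
  refine opNorm_le_bound _ (Real.sqrt_nonneg _) fun g => ?_
  have h1 : ‖g‖ ≤ m * ‖A g‖ := by
    calc ‖g‖ = ‖B (A g)‖ := by rw [← mul_apply_eq_comp, hBA, one_apply_eq_self]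
      _ ≤ ‖B‖ * ‖A g‖ := B.le_opNorm _
      _ ≤ _ := by gcongr
  have h2 : ‖adjoint A (A g)‖ ^ 2 ≤ N * ‖A g‖ ^ 2 := by
    calc ‖adjoint A (A g)‖ ^ 2 ≤ (‖adjoint A‖ * ‖A g‖) ^ 2 := by
          gcongr; exact (adjoint A).le_opNorm _
      _ = ‖A‖ ^ 2 * ‖A g‖ ^ 2 := by rw [LinearIsometryEquiv.norm_map, mul_pow]
      _ ≤ _ := by gcongr
  have h3 : ‖(1 - ((N⁻¹ : ℝ) : ℂ) • (adjoint A * A)) g‖ ^ 2 =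
      ‖g‖ ^ 2 - 2 * N⁻¹ * ‖A g‖ ^ 2 + N⁻¹ ^ 2 * ‖adjoint A (A g)‖ ^ 2 := by
    have e : (1 - ((N⁻¹ : ℝ) : ℂ) • (adjoint A * A)) g =
        g - ((N⁻¹ : ℝ) : ℂ) • adjoint A (A g) := rfl
    rw [e, @norm_sub_sq ℂ, inner_smul_right, adjoint_inner_right, norm_smul,
      inner_self_eq_norm_sq_to_K, mul_pow, Complex.norm_real, Real.norm_of_nonneg (by positivity)]
    have : RCLike.re ((((N⁻¹ : ℝ)) : ℂ) * ((‖A g‖ : ℂ)) ^ 2) = N⁻¹ * ‖A g‖ ^ 2 := by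
      norm_cast
    erw [this]
    ring
  have h4 : ‖(1 - ((N⁻¹ : ℝ) : ℂ) • (adjoint A * A)) g‖ ^ 2 ≤ (1 - N⁻¹ / m ^ 2) * ‖g‖ ^ 2 := by
    have h5 : ‖g‖ ^ 2 / m ^ 2 ≤ ‖A g‖ ^ 2 := by
      rw [div_le_iff₀ (by positivity), ← mul_pow, mul_comm]
      gcongr
    calc _ ≤ ‖g‖ ^ 2 - 2 * N⁻¹ * ‖A g‖ ^ 2 + N⁻¹ ^ 2 * (N * ‖A g‖ ^ 2) := by rw [h3]; gcongr
      _ = ‖g‖ ^ 2 - N⁻¹ * ‖A g‖ ^ 2 := by field_simp; ring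
      _ ≤ ‖g‖ ^ 2 - N⁻¹ * (‖g‖ ^ 2 / m ^ 2) := by gcongr
      _ = _ := by ring
  calc _ = Real.sqrt (‖(1 - ((N⁻¹ : ℝ) : ℂ) • (adjoint A * A)) g‖ ^ 2) :=
        (Real.sqrt_sq (norm_nonneg _)).symm
    _ ≤ _ := Real.sqrt_le_sqrt h4
    _ = _ := by rw [Real.sqrt_mul' _ (by positivity), Real.sqrt_sq (norm_nonneg _)]

end Hilbert

/-! ### From decay of repeated squares to norm-controlled inversion -/

namespace UnitalBanachAlgebra

variable {X : Type*} [NormedAddCommGroup X] [NormedSpace ℂ X] (𝔄 : UnitalBanachAlgebra X)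

/-- The ring structure of a unital Banach algebra. -/
@[reducible] noncomputable def toRing : Ring X where
  __ := (inferInstance : AddCommGroup X)
  mul a b := 𝔄.mul a b
  one := 𝔄.one
  mul_assoc := 𝔄.mul_assoc
  one_mul := 𝔄.one_mul
  mul_one := 𝔄.mul_one
  left_distrib a b c := map_add (𝔄.mul a) b c
  right_distrib a b c := by
    change 𝔄.mul (a + b) c = 𝔄.mul a c + 𝔄.mul b c
    rw [map_add, add_apply]
  zero_mul a := by
    change 𝔄.mul 0 a = 0
    rw [map_zero, zero_apply]
  mul_zero a := map_zero (𝔄.mul a)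

variable {𝔄}

theorem IsInverse.unique {a b c : X} (hb : 𝔄.IsInverse a b) (hc : 𝔄.IsInverse a c) : b = c := by
  let _ := 𝔄.toRing
  exact left_inv_eq_right_inv (M := X) hb.2 hc.1

theorem norm_mul_le (a b : X) : ‖𝔄.mul a b‖ ≤ ‖𝔄.mul‖ * ‖a‖ * ‖b‖ := 𝔄.mul.le_opNorm₂ a b

/-- The Neumann series is summed in the operators on `X`, whose norm is submultiplicative, unlike
that of the algebra itself. -/
theorem exists_apply_sub_eq (h : CompleteSpace X) (T : X →L[ℂ] X) (hT : ‖T‖ ≤ 1 / 2) (e : X) :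
    ∃ y, y - T y = e ∧ ‖y‖ ≤ 2 * ‖e‖ := by
  set u := Units.oneSub T (by linarith)
  have hy : u.1 (u⁻¹.1 e) = e := by
    rw [← mul_apply_eq_comp, u.mul_inv, one_apply_eq_self]
  have hy' : u⁻¹.1 e - T (u⁻¹.1 e) = e := hy
  refine ⟨u⁻¹.1 e, hy', ?_⟩
  set y := u⁻¹.1 e
  have h1 : ‖T y‖ ≤ 1 / 2 * ‖y‖ := (T.le_opNorm y).trans (by gcongr)
  have h2 : ‖y‖ ≤ ‖e‖ + ‖T y‖ := by
    calc ‖y‖ = ‖e + T y‖ := by rw [← hy']; simp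
      _ ≤ _ := norm_add_le _ _
  linarith

/-- Left multiplication by `x` produces a right inverse of $1-x$, right multiplication a left
inverse, and the two agree. -/
theorem exists_isInverse_one_sub (x : X) (hx : ‖𝔄.mul‖ * ‖x‖ ≤ 1 / 2) :
    ∃ e, 𝔄.IsInverse (𝔄.one - x) e ∧ ‖e‖ ≤ 2 * ‖𝔄.one‖ := by
  obtain ⟨y, hy, hyn⟩ := exists_apply_sub_eq 𝔄.complete (𝔄.mul x)
    ((𝔄.mul.le_opNorm x).trans hx) 𝔄.one
  obtain ⟨z, hz, -⟩ := exists_apply_sub_eq 𝔄.complete (𝔄.mul.flip x)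
    ((𝔄.mul.flip.le_opNorm x).trans (by rwa [ContinuousLinearMap.opNorm_flip])) 𝔄.one
  let _ := 𝔄.toRing
  have hy' : (1 - x) * y = 1 := by rw [sub_mul, _root_.one_mul]; exact hy
  have hz' : z * (1 - x) = 1 := by rw [mul_sub, _root_.mul_one]; exact hz
  have : z = y := left_inv_eq_right_inv hz' hy'
  exact ⟨y, ⟨hy', this ▸ hz'⟩, hyn⟩

/-- Descend through $(1-b)^{-1}=(1+b)(1-b^2)^{-1}$ until the iterated square is small enough for the
Neumann series; each descent worsens the bound in a way depending only on `R`. -/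
theorem exists_bound_inverse_one_sub (k : ℕ) (R : ℝ) : ∃ K : ℝ, ∀ b : X, ‖b‖ ≤ R →
    ‖𝔄.mul‖ * ‖(fun c => 𝔄.mul c c)^[k] b‖ ≤ 1 / 2 →
    ∃ e, 𝔄.IsInverse (𝔄.one - b) e ∧ ‖e‖ ≤ K := by
  induction k generalizing R with
  | zero => exact ⟨_, fun b _ hb => exists_isInverse_one_sub b hb⟩
  | succ k ih =>
    obtain ⟨K, hK⟩ := ih (‖𝔄.mul‖ * R * R)
    refine ⟨‖𝔄.mul‖ * (‖𝔄.one‖ + R) * K, fun b hb hbk => ?_⟩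
    have hR : 0 ≤ R := (norm_nonneg b).trans hb
    rw [Function.iterate_succ_apply] at hbk
    obtain ⟨e, he, heK⟩ := hK (𝔄.mul b b) ((norm_mul_le b b).trans (by gcongr)) hbk
    refine ⟨𝔄.mul (𝔄.one + b) e, ?_, (norm_mul_le _ _).trans ?_⟩
    · let _ := 𝔄.toRing
      have h1 : (1 - b * b) * e = 1 := he.1
      have h2 : e * (1 - b * b) = 1 := he.2
      have h3 : (1 - b) * ((1 + b) * e) = 1 := .trans (by noncomm_ring) h1
      have h4 : (e * (1 + b)) * (1 - b) = 1 := .trans (by noncomm_ring) h2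
      have h5 : e * (1 + b) = (1 + b) * e := left_inv_eq_right_inv h4 h3
      exact ⟨h3, (congrArg (· * (1 - b)) h5).symm.trans h4⟩
    · gcongr
      exact (norm_add_le _ _).trans (by gcongr)

variable {H : Type*} [NormedAddCommGroup H] [InnerProductSpace ℂ H] [CompleteSpace H]

open ContinuousLinearMap in
/-- A `*`-subalgebra of `B(H)` in which the powers `b ^ (2 ^ k)` of operators `b` of norm `< 1`
tend to zero, uniformly for `‖b‖` bounded and the operator norm bounded away from `1`, admits
norm-controlled inversion. -/
theorem Embedding.admitsNormControlledInversion_of_decay (ι : 𝔄.Embedding (H →L[ℂ] H))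
    (st : X → X) (hst : ∀ a, ι.toCLM (st a) = adjoint (ι.toCLM a)) (hstn : ∀ a, ‖st a‖ ≤ ‖a‖)
    (hdecay : ∀ M ρ ε : ℝ, ρ < 1 → 0 < ε → ∃ k, ∀ b : X, ‖b‖ ≤ M → ‖ι.toCLM b‖ ≤ ρ →
      ‖(fun c => 𝔄.mul c c)^[k] b‖ ≤ ε) : ι.AdmitsNormControlledInversion := by
  have key : ∀ M m : ℝ, ∃ K : ℝ≥0, ∀ a : X, ‖a‖ ≤ M → ∀ B : H →L[ℂ] H, B * ι.toCLM a = 1 →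
      ι.toCLM a * B = 1 → ‖B‖ ≤ m → ∃ b, 𝔄.IsInverse a b ∧ ‖b‖₊ ≤ K := by
    intro M m
    -- `N` dominates $\|A\|^2$ for every `a` in the ball of radius `M`; the summand 1 keeps it
    -- positive.
    set N : ℝ := (‖ι.toCLM‖ * M) ^ 2 + 1 with hN
    have hN0 : 0 < N := by positivity
    set m' : ℝ := max m 1 with hm'
    have hm0 : 0 < m' := zero_lt_one.trans_le (le_max_right _ _)
    set ρ := Real.sqrt (1 - N⁻¹ / m' ^ 2) with hρ
    have hρ1 : ρ < 1 := by
      rw [hρ, Real.sqrt_lt' one_pos]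
      have : 0 < N⁻¹ / m' ^ 2 := by positivity
      linarith
    set R : ℝ := ‖𝔄.one‖ + N⁻¹ * (‖𝔄.mul‖ * M * M) with hR
    obtain ⟨k, hk⟩ := hdecay R ρ (1 / (2 * (‖𝔄.mul‖ + 1))) hρ1 (by positivity)
    obtain ⟨K, hK⟩ := exists_bound_inverse_one_sub (𝔄 := 𝔄) k R
    refine ⟨Real.toNNReal (N⁻¹ * (‖𝔄.mul‖ * K * M)), fun a ha B hBA hAB hB => ?_⟩
    have hM : 0 ≤ M := (norm_nonneg a).trans ha
    set c : ℂ := ((N⁻¹ : ℝ) : ℂ) with hc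
    have hcn : ‖c‖ = N⁻¹ := by
      rw [hc, Complex.norm_real, Real.norm_of_nonneg (by positivity)]
    set b := 𝔄.one - c • 𝔄.mul (st a) a with hb
    have hbR : ‖b‖ ≤ R := by
      refine (norm_sub_le _ _).trans ?_
      rw [norm_smul, hcn, hR]
      gcongr
      refine (norm_mul_le _ _).trans ?_
      have := hstn a
      gcongr
      exact this.trans ha
    have hιb : ‖ι.toCLM b‖ ≤ ρ := by
      have : ι.toCLM b = 1 - c • (adjoint (ι.toCLM a) * ι.toCLM a) := by
        rw [hb, map_sub, ι.map_one, map_smul, ι.map_mul, hst]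
      rw [this]
      refine norm_one_sub_smul_adjoint_mul_le hBA hN0 ?_ hm0 (hB.trans (le_max_left _ _))
      calc ‖ι.toCLM a‖ ^ 2 ≤ (‖ι.toCLM‖ * M) ^ 2 := by
            gcongr; exact (ι.toCLM.le_opNorm a).trans (by gcongr)
        _ ≤ N := by rw [hN]; linarith
    obtain ⟨e, he, heK⟩ := hK b hbR (by
      calc ‖𝔄.mul‖ * _ ≤ ‖𝔄.mul‖ * (1 / (2 * (‖𝔄.mul‖ + 1))) := by
            gcongr; exact hk b hbR hιb
        _ ≤ 1 / 2 := by
            rw [mul_one_div, div_le_div_iff₀ (by positivity) two_pos]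
            linarith)
    have hba : 𝔄.mul (c • 𝔄.mul e (st a)) a = 𝔄.one := by
      have h1 : 𝔄.one - b = c • 𝔄.mul (st a) a := by rw [hb]; simp
      have h2 := he.2
      rw [h1, map_smul, ← 𝔄.mul_assoc] at h2
      rw [map_smul]
      exact h2
    -- Only a left inverse has been built in the algebra. Its image must be `B`, so it is also a
    -- right inverse, by injectivity of the embedding.
    have hι : ι.toCLM (c • 𝔄.mul e (st a)) = B := by
      have : ι.toCLM (c • 𝔄.mul e (st a)) * ι.toCLM a = 1 := by
        rw [← ι.map_mul, hba, ι.map_one]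
      exact left_inv_eq_right_inv this hAB
    refine ⟨c • 𝔄.mul e (st a), ⟨ι.injective ?_, hba⟩, ?_⟩
    · rw [ι.map_mul, hι, hAB, ι.map_one]
    · rw [← NNReal.coe_le_coe, coe_nnnorm]
      refine le_trans ?_ (Real.le_coe_toNNReal _)
      rw [norm_smul, hcn]
      gcongr
      refine (norm_mul_le _ _).trans ?_
      have := hstn a
      have hK0 : 0 ≤ K := (norm_nonneg e).trans heK
      gcongr
      exact (hstn a).trans ha
  refine ⟨fun a ⟨u, hu⟩ => ?_, ?_⟩
  · obtain ⟨K, hK⟩ := key ‖a‖ ‖u⁻¹.1‖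
    obtain ⟨b, hb, -⟩ := hK a le_rfl u⁻¹.1 (by rw [← hu]; simp) (by rw [← hu]; simp) le_rfl
    exact ⟨b, hb⟩
  · choose K hK using key
    refine ⟨fun M m => K M m, fun a b hab => ?_⟩
    obtain ⟨b', hb', hn⟩ := hK ‖a‖ ‖ι.toCLM b‖ a le_rfl (ι.toCLM b)
      (by rw [← ι.map_mul, hab.2, ι.map_one]) (by rw [← ι.map_mul, hab.1, ι.map_one]) le_rfl
    rw [hab.unique hb']
    rw [hab.unique hb'] at hn
    exact hn

end UnitalBanachAlgebra

/-! ### The weighted convolution algebra: completeness and product estimates -/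

-- The map $f\mapsto(\omega f,f)$ is an isometry into $L^p\times L^2$. Its range is closed because a
-- subsequence converges almost everywhere in both coordinates.
open Filter in
theorem WeightedSpace.completeSpace {G : Type*} [MeasurableSpace G] {μ : Measure G} {p : ℝ≥0∞}
    [Fact (1 ≤ p)] {ω : G → ℝ} : CompleteSpace (WeightedSpace p ω μ) := by
  have hmem : ∀ f : WeightedSpace p ω μ, MemLp (fun x => (ω x : ℂ) * toL2 f x) p μ := fun f => f.2
  set j : WeightedSpace p ω μ → Lp ℂ p μ × Lp ℂ 2 μ := fun f => ((hmem f).toLp _, toL2 f) with hj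
  have hjn : ∀ f g, j f - j g = j (f - g) := fun f g => by
    refine Prod.ext ?_ (map_sub toL2 f g).symm
    simp only [hj, Prod.fst_sub]
    rw [← MemLp.toLp_sub]
    refine (MemLp.toLp_eq_toLp_iff _ _).2 ?_
    filter_upwards [Lp.coeFn_sub (toL2 f) (toL2 g)] with x hx
    rw [map_sub, hx]
    simp [mul_sub]
  have hiso : Isometry j := Isometry.of_dist_eq fun f g => by
    rw [dist_eq_norm, dist_eq_norm, hjn, WeightedSpace.norm_def, Prod.norm_def]
    simp only [hj, Lp.norm_toLp, wnorm]
  rw [completeSpace_iff_isComplete_range hiso.isUniformInducing]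
  refine IsClosed.isComplete (IsSeqClosed.isClosed ?_)
  rintro u ⟨F, f⟩ hu hlim
  choose v hv using hu
  have h1 : Tendsto (fun n => (u n).1) atTop (𝓝 F) := (continuous_fst.tendsto _).comp hlim
  have h2 : Tendsto (fun n => (u n).2) atTop (𝓝 f) := (continuous_snd.tendsto _).comp hlim
  obtain ⟨ns, hns, hF⟩ := (tendstoInMeasure_of_tendsto_Lp h1).exists_seq_tendsto_ae
  obtain ⟨ms, hms, hf⟩ :=
    (tendstoInMeasure_of_tendsto_Lp (h2.comp hns.tendsto_atTop)).exists_seq_tendsto_ae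
  have hω : (fun x => (ω x : ℂ) * f x) =ᵐ[μ] F := by
    have hall : ∀ᵐ x ∂μ, ∀ n, (u n).1 x = (ω x : ℂ) * (u n).2 x := by
      rw [ae_all_iff]
      intro n
      rw [← hv n]
      exact (hmem (v n)).coeFn_toLp
    filter_upwards [hF, hf, hall] with x hx1 hx2 hx3
    refine tendsto_nhds_unique (hx2.const_mul (ω x : ℂ)) ?_
    refine (hx1.comp hms.tendsto_atTop).congr fun n => ?_
    simp [hx3]
  have hfm : MemLp (fun x => (ω x : ℂ) * f x) p μ := (memLp_congr_ae hω).2 (Lp.memLp F)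
  refine ⟨⟨f, hfm⟩, Prod.ext ?_ rfl⟩
  exact Lp.ext ((hmem ⟨f, hfm⟩).coeFn_toLp.trans hω)

/-- A symmetric weight `ω ≥ 1` that satisfies `ω (x y) ≤ C (ω(x) σ(y) + σ(x) ω(y))` for a smaller
weight `σ` whose weighted `L¹` norm interpolates between the norms of `L^p(G,ω)` and `L²(G)`. -/
structure IsControlledWeight {G : Type*} [Group G] [MeasurableSpace G] (μ : Measure G) (p : ℝ≥0∞)
    (ω σ : G → ℝ) (C D : ℝ≥0) (θ : ℝ) : Prop where
  measurable : Measurable ω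
  measurable_aux : Measurable σ
  one_le : ∀ x, 1 ≤ ω x
  one_le_aux : ∀ x, 1 ≤ σ x
  map_inv : ∀ x, ω x⁻¹ = ω x
  map_mul_le : ∀ x y, ω (x * y) ≤ C * (ω x * σ y + σ x * ω y)
  exponent_pos : 0 < θ
  exponent_lt_one : θ < 1
  interpolation : ∀ f : G → ℂ, AEStronglyMeasurable f μ →
    eLpNorm (fun x => (σ x : ℂ) * f x) 1 μ ≤
      D * eLpNorm (fun x => (ω x : ℂ) * f x) p μ ^ θ * eLpNorm f 2 μ ^ (1 - θ)

namespace WeightedSpace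

variable {G : Type*} [MeasurableSpace G] {μ : Measure G} {p : ℝ≥0∞} {ω : G → ℝ}

theorem memLp_two (f : WeightedSpace p ω μ) : MemLp (toL2 f) 2 μ := Lp.memLp _

theorem memLp_weight (f : WeightedSpace p ω μ) : MemLp (fun x => (ω x : ℂ) * toL2 f x) p μ := f.2

/-- The element of `L^p(G,ω) ∩ L^2(G)` given by a function. -/
noncomputable def mk {f : G → ℂ} (h2 : MemLp f 2 μ) (hp : MemLp (fun x => (ω x : ℂ) * f x) p μ) :
    WeightedSpace p ω μ :=
  ⟨h2.toLp f, (memLp_congr_ae (by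
    filter_upwards [h2.coeFn_toLp] with x hx
    rw [hx])).1 hp⟩

theorem coeFn_mk {f : G → ℂ} (h2 : MemLp f 2 μ) (hp : MemLp (fun x => (ω x : ℂ) * f x) p μ) :
    toL2 (mk h2 hp) =ᵐ[μ] f := h2.coeFn_toLp

theorem wnorm_mk {f : G → ℂ} (h2 : MemLp f 2 μ) (hp : MemLp (fun x => (ω x : ℂ) * f x) p μ) :
    wnorm (mk h2 hp) = eLpNorm (fun x => (ω x : ℂ) * f x) p μ := by
  refine eLpNorm_congr_ae ?_
  filter_upwards [coeFn_mk h2 hp] with x hx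
  rw [hx]

theorem toL2_mk {f : G → ℂ} (h2 : MemLp f 2 μ) (hp : MemLp (fun x => (ω x : ℂ) * f x) p μ) :
    toL2 (mk h2 hp) = h2.toLp f := rfl

theorem toL2_injective : Function.Injective (toL2 (p := p) (ω := ω) (μ := μ)) :=
  Subtype.val_injective

theorem norm_toL2_le (f : WeightedSpace p ω μ) : ‖toL2 f‖ ≤ ‖f‖ := le_max_right _ _

theorem wnorm_le (f : WeightedSpace p ω μ) : (wnorm f).toReal ≤ ‖f‖ := le_max_left _ _

end WeightedSpace

namespace IsControlledWeight

open WeightedSpace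

section Basic

variable {G : Type*} [Group G] [MeasurableSpace G] {μ : Measure G} {p : ℝ≥0∞} {ω σ : G → ℝ}
  {C D : ℝ≥0} {θ : ℝ} (h : IsControlledWeight μ p ω σ C D θ)

include h

theorem pos (x : G) : 0 < ω x := zero_lt_one.trans_le (h.one_le x)

theorem pos_aux (x : G) : 0 < σ x := zero_lt_one.trans_le (h.one_le_aux x)

theorem memLp_aux (f : WeightedSpace p ω μ) : MemLp (fun x => (σ x : ℂ) * toL2 f x) 1 μ := by
  refine ⟨(Complex.measurable_ofReal.comp h.measurable_aux).aestronglyMeasurable.mul f.memLp_two.1,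
    (h.interpolation _ f.memLp_two.1).trans_lt ?_⟩
  refine ENNReal.mul_lt_top (ENNReal.mul_lt_top ENNReal.coe_lt_top ?_) ?_
  · exact ENNReal.rpow_lt_top_of_nonneg h.exponent_pos.le f.memLp_weight.2.ne
  · exact ENNReal.rpow_lt_top_of_nonneg (by linarith [h.exponent_lt_one]) f.memLp_two.2.ne

theorem eLpNorm_one_le (f : G → ℂ) : eLpNorm f 1 μ ≤ eLpNorm (fun x => (σ x : ℂ) * f x) 1 μ := by
  refine eLpNorm_mono fun x => ?_
  rw [norm_mul, Complex.norm_real, Real.norm_of_nonneg (h.pos_aux x).le]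
  exact le_mul_of_one_le_left (norm_nonneg _) (h.one_le_aux x)

theorem memLp_one (f : WeightedSpace p ω μ) : MemLp (toL2 f) 1 μ :=
  ⟨f.memLp_two.1, (h.eLpNorm_one_le _).trans_lt (h.memLp_aux f).2⟩

end Basic

/-- `‖f σ‖_1`. -/
noncomputable def auxNorm {G : Type*} [MeasurableSpace G] {μ : Measure G} {p : ℝ≥0∞} {ω : G → ℝ}
    (σ : G → ℝ) (f : WeightedSpace p ω μ) : ℝ :=
  (eLpNorm (fun x => (σ x : ℂ) * toL2 f x) 1 μ).toReal

section Norms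

variable {G : Type*} [Group G] [MeasurableSpace G] {μ : Measure G} {p : ℝ≥0∞} {ω σ : G → ℝ}
  {C D : ℝ≥0} {θ : ℝ} (h : IsControlledWeight μ p ω σ C D θ)

include h

theorem auxNorm_le (f : WeightedSpace p ω μ) :
    auxNorm σ f ≤ D * ‖f‖ ^ θ * ‖toL2 f‖ ^ (1 - θ) := by
  have hθ := h.exponent_pos
  have h1 : 0 ≤ 1 - θ := by linarith [h.exponent_lt_one]
  have key := ENNReal.toReal_mono ?_ (h.interpolation _ f.memLp_two.1)
  · refine key.trans ?_
    rw [ENNReal.toReal_mul, ENNReal.toReal_mul, ← ENNReal.toReal_rpow, ← ENNReal.toReal_rpow,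
      ENNReal.coe_toReal, ← Lp.norm_def]
    gcongr
    exact f.wnorm_le
  · refine ENNReal.mul_ne_top (ENNReal.mul_ne_top ENNReal.coe_ne_top ?_) ?_
    · exact (ENNReal.rpow_lt_top_of_nonneg hθ.le f.memLp_weight.2.ne).ne
    · exact (ENNReal.rpow_lt_top_of_nonneg h1 f.memLp_two.2.ne).ne

theorem auxNorm_le_mul_norm (f : WeightedSpace p ω μ) : auxNorm σ f ≤ D * ‖f‖ := by
  have h1 : 0 ≤ 1 - θ := by linarith [h.exponent_lt_one]
  have h0 : 0 ≤ ‖f‖ := (norm_nonneg _).trans f.norm_toL2_le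
  calc auxNorm σ f ≤ D * ‖f‖ ^ θ * ‖toL2 f‖ ^ (1 - θ) := h.auxNorm_le f
    _ ≤ D * ‖f‖ ^ θ * ‖f‖ ^ (1 - θ) := by gcongr; exact f.norm_toL2_le
    _ = D * ‖f‖ := by
      rw [mul_assoc, ← Real.rpow_add_of_nonneg h0 h.exponent_pos.le h1]
      simp

end Norms

section Algebra

variable {G : Type*} [Group G] [TopologicalSpace G] [IsTopologicalGroup G]
  [LocallyCompactSpace G] [T2Space G] [SigmaCompactSpace G] [MeasurableSpace G] [BorelSpace G]
  {μ : Measure G} [μ.IsHaarMeasure] [μ.Regular] [μ.IsInvInvariant]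
  {p : ℝ≥0∞} {ω σ : G → ℝ} {C D : ℝ≥0} {θ : ℝ}

/-- Split $x=y\cdot(y^{-1}x)$ under the integral and apply the weight inequality. -/
theorem enorm_weight_mul_groupConv_le (h : IsControlledWeight μ p ω σ C D θ) {f g : G → ℂ}
    (hf : AEStronglyMeasurable f μ) (hg : AEStronglyMeasurable g μ) (x : G) :
    ‖(ω x : ℂ) * groupConv μ f g x‖ₑ ≤
      C * (groupLConv μ (fun y => (ω y : ℂ) * f y) (fun y => (σ y : ℂ) * g y) x +
        groupLConv μ (fun y => (σ y : ℂ) * f y) (fun y => (ω y : ℂ) * g y) x) := by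
  have hmω : AEStronglyMeasurable (fun y => (ω y : ℂ)) μ :=
    (Complex.measurable_ofReal.comp h.measurable).aestronglyMeasurable
  have hmσ : AEStronglyMeasurable (fun y => (σ y : ℂ)) μ :=
    (Complex.measurable_ofReal.comp h.measurable_aux).aestronglyMeasurable
  have hpt : ∀ y, ‖(ω x : ℂ)‖ₑ * (‖f y‖ₑ * ‖g (y⁻¹ * x)‖ₑ) ≤
      C * (‖(ω y : ℂ) * f y‖ₑ * ‖(σ (y⁻¹ * x) : ℂ) * g (y⁻¹ * x)‖ₑ +
        ‖(σ y : ℂ) * f y‖ₑ * ‖(ω (y⁻¹ * x) : ℂ) * g (y⁻¹ * x)‖ₑ) := fun y => by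
    have hn : ∀ r : ℝ, 0 < r → ‖(r : ℂ)‖ = r := fun r hr => by
      rw [Complex.norm_real, Real.norm_of_nonneg hr.le]
    have hr : ‖(ω x : ℂ)‖₊ * (‖f y‖₊ * ‖g (y⁻¹ * x)‖₊) ≤
      C * (‖(ω y : ℂ) * f y‖₊ * ‖(σ (y⁻¹ * x) : ℂ) * g (y⁻¹ * x)‖₊ +
        ‖(σ y : ℂ) * f y‖₊ * ‖(ω (y⁻¹ * x) : ℂ) * g (y⁻¹ * x)‖₊) := by
      rw [← NNReal.coe_le_coe]
      push_cast
      simp only [norm_mul, hn _ (h.pos _), hn _ (h.pos_aux _)]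
      have := h.map_mul_le y (y⁻¹ * x)
      rw [mul_inv_cancel_left] at this
      calc _ ≤ (C * (ω y * σ (y⁻¹ * x) + σ y * ω (y⁻¹ * x))) * (‖f y‖ * ‖g (y⁻¹ * x)‖) := by
            gcongr
        _ = _ := by ring
    simp only [enorm_eq_nnnorm]
    exact_mod_cast hr
  rw [enorm_mul]
  calc ‖(ω x : ℂ)‖ₑ * ‖groupConv μ f g x‖ₑ ≤ ‖(ω x : ℂ)‖ₑ * groupLConv μ f g x := by
        gcongr; exact enorm_groupConv_le μ f g x
    _ = ∫⁻ y, ‖(ω x : ℂ)‖ₑ * (‖f y‖ₑ * ‖g (y⁻¹ * x)‖ₑ) ∂μ := by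
        rw [groupLConv, lintegral_const_mul' _ _ enorm_ne_top]
    _ ≤ _ := lintegral_mono hpt
    _ = _ := by
        rw [lintegral_const_mul' _ _ ENNReal.coe_ne_top, lintegral_add_left', groupLConv,
          groupLConv]
        exact (hmω.mul hf).enorm.mul ((hmσ.mul hg).comp_quasiMeasurePreserving
          (measurePreserving_inv_mul_right (μ := μ) x).quasiMeasurePreserving).enorm

variable [Fact (1 ≤ p)] (hp : p ≠ ∞) (h : IsControlledWeight μ p ω σ C D θ)

-- Each of the two convolutions has one factor in weighted $L^p$ and one in $L^1(\sigma)$, so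
-- Young's inequality applies to each from its own side.
include hp h in
theorem eLpNorm_weight_mul_groupConv_le (f g : WeightedSpace p ω μ) :
    eLpNorm (fun x => (ω x : ℂ) * groupConv μ (toL2 f) (toL2 g) x) p μ ≤
      C * (wnorm f * eLpNorm (fun x => (σ x : ℂ) * toL2 g x) 1 μ +
        eLpNorm (fun x => (σ x : ℂ) * toL2 f x) 1 μ * wnorm g) := by
  have hp1 : 1 ≤ p := Fact.out
  have hm1 := measurable_groupLConv le_rfl ENNReal.one_ne_top f.memLp_weight.1 (h.memLp_aux g)
  have hm2 := measurable_groupLConv hp1 hp (h.memLp_aux f).1 g.memLp_weight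
  refine (eLpNorm_le_nnreal_smul_eLpNorm_of_ae_le_mul' (c := C)
    (g := groupLConv μ (fun y => (ω y : ℂ) * toL2 f y) (fun y => (σ y : ℂ) * toL2 g y) +
        groupLConv μ (fun y => (σ y : ℂ) * toL2 f y) (fun y => (ω y : ℂ) * toL2 g y))
    (Filter.Eventually.of_forall fun x => ?_) p).trans ?_
  · exact h.enorm_weight_mul_groupConv_le f.memLp_two.1 g.memLp_two.1 x
  · rw [ENNReal.smul_def, smul_eq_mul]
    gcongr
    refine (eLpNorm_add_le hm1.aestronglyMeasurable hm2.aestronglyMeasurable hp1).trans ?_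
    gcongr
    · exact eLpNorm_groupLConv_le_right hp1 hp f.memLp_weight (h.memLp_aux g)
    · exact eLpNorm_groupLConv_le_left hp1 hp (h.memLp_aux f) g.memLp_weight

include hp h in
theorem memLp_weight_mul_groupConv (f g : WeightedSpace p ω μ) :
    MemLp (fun x => (ω x : ℂ) * groupConv μ (toL2 f) (toL2 g) x) p μ := by
  refine ⟨?_, (eLpNorm_weight_mul_groupConv_le hp h f g).trans_lt ?_⟩
  · exact (Complex.measurable_ofReal.comp h.measurable).aestronglyMeasurable.mul
      (stronglyMeasurable_groupConv one_le_two ENNReal.ofNat_ne_top f.memLp_two.1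
        g.memLp_two).aestronglyMeasurable
  · exact ENNReal.mul_lt_top ENNReal.coe_lt_top (ENNReal.add_lt_top.2
      ⟨ENNReal.mul_lt_top f.wnorm_lt_top (h.memLp_aux g).2,
        ENNReal.mul_lt_top (h.memLp_aux f).2 g.wnorm_lt_top⟩)

include h in
theorem memLp_groupConv_two (f : WeightedSpace p ω μ) (g : Lp ℂ 2 μ) :
    MemLp (groupConv μ (toL2 f) g) 2 μ :=
  memLp_groupConv one_le_two ENNReal.ofNat_ne_top (h.memLp_one f) (Lp.memLp g)

/-- The action `g ↦ f ∗ g` of `L^p(G,ω) ∩ L^2(G)` on `L^2(G)`. -/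
noncomputable def convL2 (f : WeightedSpace p ω μ) (g : Lp ℂ 2 μ) : Lp ℂ 2 μ :=
  (h.memLp_groupConv_two f g).toLp _

/-- The convolution product of `L^p(G,ω) ∩ L^2(G)`. -/
noncomputable def conv (f g : WeightedSpace p ω μ) : WeightedSpace p ω μ :=
  WeightedSpace.mk (h.memLp_groupConv_two f (toL2 g)) (memLp_weight_mul_groupConv hp h f g)

theorem coeFn_convL2 (f : WeightedSpace p ω μ) (g : Lp ℂ 2 μ) :
    h.convL2 f g =ᵐ[μ] groupConv μ (toL2 f) g := MemLp.coeFn_toLp _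

theorem toL2_conv (f g : WeightedSpace p ω μ) : toL2 (conv hp h f g) = h.convL2 f (toL2 g) := rfl

theorem isConvolution_convL2 (f : WeightedSpace p ω μ) (g : Lp ℂ 2 μ) :
    IsConvolution μ (toL2 f) g (h.convL2 f g) := by
  filter_upwards [h.coeFn_convL2 f g] with x hx
  exact ⟨integrable_groupConv f.memLp_two (Lp.memLp g) x, hx⟩

theorem convL2_add_left (f₁ f₂ : WeightedSpace p ω μ) (g : Lp ℂ 2 μ) :
    h.convL2 (f₁ + f₂) g = h.convL2 f₁ g + h.convL2 f₂ g := by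
  refine Lp.ext ((h.coeFn_convL2 _ _).trans ?_)
  rw [map_add, groupConv_congr (g' := g) (Lp.coeFn_add (toL2 f₁) (toL2 f₂)) ae_eq_rfl,
    groupConv_add_left f₁.memLp_two f₂.memLp_two (Lp.memLp g)]
  exact ((h.coeFn_convL2 f₁ g).add (h.coeFn_convL2 f₂ g)).symm.trans (Lp.coeFn_add _ _).symm

theorem convL2_add_right (f : WeightedSpace p ω μ) (g₁ g₂ : Lp ℂ 2 μ) :
    h.convL2 f (g₁ + g₂) = h.convL2 f g₁ + h.convL2 f g₂ := by
  refine Lp.ext ((h.coeFn_convL2 _ _).trans ?_)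
  rw [groupConv_congr (f' := toL2 f) ae_eq_rfl (Lp.coeFn_add g₁ g₂),
    groupConv_add_right f.memLp_two (Lp.memLp g₁) (Lp.memLp g₂)]
  exact ((h.coeFn_convL2 f g₁).add (h.coeFn_convL2 f g₂)).symm.trans (Lp.coeFn_add _ _).symm

theorem convL2_smul_left (c : ℂ) (f : WeightedSpace p ω μ) (g : Lp ℂ 2 μ) :
    h.convL2 (c • f) g = c • h.convL2 f g := by
  refine Lp.ext ((h.coeFn_convL2 _ _).trans ?_)
  rw [map_smul, groupConv_congr (g' := g) (Lp.coeFn_smul c (toL2 f)) ae_eq_rfl, groupConv_smul_left]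
  exact ((h.coeFn_convL2 f g).const_smul c).symm.trans (Lp.coeFn_smul _ _).symm

theorem convL2_smul_right (c : ℂ) (f : WeightedSpace p ω μ) (g : Lp ℂ 2 μ) :
    h.convL2 f (c • g) = c • h.convL2 f g := by
  refine Lp.ext ((h.coeFn_convL2 _ _).trans ?_)
  rw [groupConv_congr (f' := toL2 f) ae_eq_rfl (Lp.coeFn_smul c g), groupConv_smul_right]
  exact ((h.coeFn_convL2 f g).const_smul c).symm.trans (Lp.coeFn_smul _ _).symm

theorem norm_convL2_le (f : WeightedSpace p ω μ) (g : Lp ℂ 2 μ) :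
    ‖h.convL2 f g‖ ≤ auxNorm σ f * ‖g‖ := by
  rw [convL2, Lp.norm_toLp, auxNorm, Lp.norm_def, ← ENNReal.toReal_mul]
  refine ENNReal.toReal_mono (ENNReal.mul_ne_top (h.memLp_aux f).2.ne (Lp.memLp g).2.ne) ?_
  refine (eLpNorm_groupConv_le_left one_le_two ENNReal.ofNat_ne_top (h.memLp_one f)
    (Lp.memLp g)).trans ?_
  gcongr
  exact h.eLpNorm_one_le _

theorem norm_convL2_le_right (f : WeightedSpace p ω μ) (g : Lp ℂ 2 μ) (hg : MemLp g 1 μ) :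
    ‖h.convL2 f g‖ ≤ ‖toL2 f‖ * (eLpNorm g 1 μ).toReal := by
  rw [convL2, Lp.norm_toLp, Lp.norm_def, ← ENNReal.toReal_mul]
  refine ENNReal.toReal_mono (ENNReal.mul_ne_top f.memLp_two.2.ne hg.2.ne) ?_
  exact eLpNorm_groupConv_le_right one_le_two ENNReal.ofNat_ne_top f.memLp_two hg

/-- The constant $C+1$ serves both parts of the maximum: the weighted $L^p$ bound has constant $C$,
the $L^2$ bound constant 1. -/
theorem norm_conv_le (f g : WeightedSpace p ω μ) :
    ‖conv hp h f g‖ ≤ (C + 1) * (‖f‖ * auxNorm σ g + auxNorm σ f * ‖g‖) := by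
  have h0 : ∀ k : WeightedSpace p ω μ, 0 ≤ auxNorm σ k := fun k => ENNReal.toReal_nonneg
  have hf := h0 f
  have hg := h0 g
  have hCnn := C.2
  refine max_le ?_ ?_
  · have h1 := eLpNorm_weight_mul_groupConv_le hp h f g
    rw [conv, wnorm_mk]
    have hA : wnorm f * eLpNorm (fun x => (σ x : ℂ) * toL2 g x) 1 μ ≠ ∞ :=
      ENNReal.mul_ne_top f.wnorm_lt_top.ne (h.memLp_aux g).2.ne
    have hB : eLpNorm (fun x => (σ x : ℂ) * toL2 f x) 1 μ * wnorm g ≠ ∞ :=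
      ENNReal.mul_ne_top (h.memLp_aux f).2.ne g.wnorm_lt_top.ne
    have h2 := ENNReal.toReal_mono
      (ENNReal.mul_ne_top ENNReal.coe_ne_top (ENNReal.add_ne_top.2 ⟨hA, hB⟩)) h1
    rw [ENNReal.toReal_mul, ENNReal.toReal_add hA hB, ENNReal.toReal_mul, ENNReal.toReal_mul,
      ENNReal.coe_toReal] at h2
    refine h2.trans ?_
    gcongr
    · exact le_add_of_nonneg_right zero_le_one
    · exact f.wnorm_le
    · exact le_rfl
    · exact le_rfl
    · exact g.wnorm_le
  · rw [toL2_conv]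
    calc _ ≤ auxNorm σ f * ‖toL2 g‖ := h.norm_convL2_le f _
      _ ≤ 1 * (0 + auxNorm σ f * ‖g‖) := by rw [one_mul, zero_add]; gcongr; exact g.norm_toL2_le
      _ ≤ _ := by
        gcongr
        · exact le_add_of_nonneg_left hCnn
        · positivity

theorem convL2_conv (f g : WeightedSpace p ω μ) (k : Lp ℂ 2 μ) :
    h.convL2 (conv hp h f g) k = h.convL2 f (h.convL2 g k) := by
  refine Lp.ext ((h.coeFn_convL2 _ _).trans ?_)
  rw [toL2_conv, groupConv_congr (g' := k) (h.coeFn_convL2 f (toL2 g)) ae_eq_rfl,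
    groupConv_assoc (h.memLp_one f) g.memLp_two (Lp.memLp k)]
  refine Filter.EventuallyEq.trans ?_ (h.coeFn_convL2 _ _).symm
  rw [groupConv_congr (f' := toL2 f) ae_eq_rfl (h.coeFn_convL2 g k)]

end Algebra

end IsControlledWeight

/-! ### Small open sets and continuity of $L^2*L^2$ -/

section Haar

variable {G : Type*} [Group G] [TopologicalSpace G] [IsTopologicalGroup G]
  [LocallyCompactSpace G] [T2Space G] [MeasurableSpace G] [BorelSpace G]
  {μ : Measure G} [μ.IsHaarMeasure] [μ.Regular]

theorem exists_isOpen_measure_lt (hG : ¬ DiscreteTopology G) {ε : ℝ≥0∞} (hε : ε ≠ 0) :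
    ∃ U : Set G, IsOpen U ∧ U.Nonempty ∧ μ U < ε := by
  have : (𝓝[≠] (1 : G)).NeBot := by
    refine ⟨fun h => hG ?_⟩
    exact discreteTopology_of_isOpen_singleton_one (isOpen_singleton_iff_punctured_nhds 1 |>.2 h)
  obtain ⟨U, h1, hU, hμ⟩ := Set.exists_isOpen_lt_of_lt ({1} : Set G) ε
    (by rw [measure_singleton (μ := μ)]; exact pos_iff_ne_zero.2 hε)
  exact ⟨U, hU, ⟨1, h1 rfl⟩, hμ⟩

-- With $v(y)=g(y^{-1})$, the value $(f*g)(x)$ is the inner product of $\bar f$ with the translate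
-- $y\mapsto v(x^{-1}y)$, and translation is continuous in $L^2$.
open DomMulAct in
theorem continuous_groupConv [μ.IsInvInvariant] {f g : G → ℂ} (hf : MemLp f 2 μ)
    (hg : MemLp g 2 μ) : Continuous (groupConv μ f g) := by
  have : Fact ((2 : ℝ≥0∞) ≠ ∞) := ⟨ENNReal.ofNat_ne_top⟩
  have hg' : MemLp (fun y => g y⁻¹) 2 μ :=
    hg.comp_measurePreserving (Measure.measurePreserving_inv μ)
  set u : Lp ℂ 2 μ := hf.star.toLp _
  set v : Lp ℂ 2 μ := hg'.toLp _ with hv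
  have key : ∀ x, groupConv μ f g x = inner ℂ u (DomMulAct.mk x⁻¹ • v) := fun x => by
    rw [L2.inner_def, groupConv]
    refine integral_congr_ae ?_
    have e : DomMulAct.mk x⁻¹ • v =
      (hg'.comp_measurePreserving (measurePreserving_smul x⁻¹ μ)).toLp _ :=
      DomMulAct.mk_smul_toLp x⁻¹ hg'
    filter_upwards [hf.star.coeFn_toLp, e ▸ MemLp.coeFn_toLp
      (hg'.comp_measurePreserving (measurePreserving_smul x⁻¹ μ))] with y h1 h2
    rw [h1, h2]
    simp [mul_comm]
  have : Continuous fun x : G => (inner ℂ u (DomMulAct.mk x⁻¹ • v) : ℂ) := by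
    have : Continuous fun x : G => DomMulAct.mk x⁻¹ :=
      DomMulAct.continuous_mk.comp continuous_inv
    fun_prop
  exact this.congr fun x => (key x).symm

end Haar

/-! ### The unitization, its action on $L^2(G)$, and norm control -/

namespace IsControlledWeight

open WeightedSpace

section Algebra

variable {G : Type*} [Group G] [TopologicalSpace G] [IsTopologicalGroup G]
  [LocallyCompactSpace G] [T2Space G] [SigmaCompactSpace G] [MeasurableSpace G] [BorelSpace G]
  {μ : Measure G} [μ.IsHaarMeasure] [μ.Regular] [μ.IsInvInvariant]
  {p : ℝ≥0∞} {ω σ : G → ℝ} {C D : ℝ≥0} {θ : ℝ}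
  [Fact (1 ≤ p)] (hp : p ≠ ∞) (h : IsControlledWeight μ p ω σ C D θ)

/-- The involution `f^*(x) = conj f(x⁻¹)`. -/
noncomputable def involution (f : WeightedSpace p ω μ) : WeightedSpace p ω μ :=
  WeightedSpace.mk (f := fun x => star (toL2 f x⁻¹))
    (f.memLp_two.comp_measurePreserving (Measure.measurePreserving_inv μ)).star (by
      refine (memLp_congr_ae (Filter.Eventually.of_forall fun x => ?_)).1
        (f.memLp_weight.comp_measurePreserving (Measure.measurePreserving_inv μ)).star
      simp [h.map_inv])

theorem coeFn_involution (f : WeightedSpace p ω μ) :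
    toL2 (h.involution f) =ᵐ[μ] fun x => star (toL2 f x⁻¹) := coeFn_mk _ _

theorem norm_involution (f : WeightedSpace p ω μ) : ‖h.involution f‖ = ‖f‖ := by
  have e : ∀ (g : G → ℂ) (r : ℝ≥0∞), AEStronglyMeasurable g μ →
      eLpNorm (fun x => star (g x⁻¹)) r μ = eLpNorm g r μ := fun g r hg => by
    rw [← eLpNorm_comp_measurePreserving hg (Measure.measurePreserving_inv μ)]
    exact eLpNorm_congr_norm_ae (Filter.Eventually.of_forall fun x => by simp)
  rw [norm_def, norm_def, involution, wnorm_mk, toL2_mk, Lp.norm_toLp, e _ _ f.memLp_two.1,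
    Lp.norm_def, wnorm, ← e _ _ f.memLp_weight.1]
  simp [h.map_inv]

theorem inner_convL2_involution (f : WeightedSpace p ω μ) (k g : Lp ℂ 2 μ) :
    inner ℂ (h.convL2 (h.involution f) k) g = (inner ℂ k (h.convL2 f g) : ℂ) := by
  have hk : MemLp (fun x => star (k x)) 2 μ := (Lp.memLp k).star
  have h1 := integral_groupConv_mul_eq_inv (h.memLp_one f) (Lp.memLp g) hk
  have h2 : ∀ x, groupConv μ (fun y => toL2 f y⁻¹) (fun x => star (k x)) x =
      star (groupConv μ (fun y => star (toL2 f y⁻¹)) k x) := fun x => by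
    simp only [groupConv, RCLike.star_def]
    rw [← integral_conj]
    simp
  rw [L2.inner_def, L2.inner_def]
  calc _ = ∫ z, g z * groupConv μ (fun y => toL2 f y⁻¹) (fun x => star (k x)) z ∂μ := by
        refine integral_congr_ae ?_
        filter_upwards [h.coeFn_convL2 (h.involution f) k] with x hx
        rw [hx, h2, groupConv_congr (g' := k) (h.coeFn_involution f) ae_eq_rfl]
        simp
    _ = _ := by
        rw [← h1]
        refine integral_congr_ae ?_
        filter_upwards [h.coeFn_convL2 f g] with x hx
        rw [hx]
        simp

/-- Test on $f^*$: the value of $f*f^*$ at the identity is $\|f\|_2^2$. -/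
theorem eq_zero_of_convL2_eq_zero (f : WeightedSpace p ω μ) (hf : ∀ g, h.convL2 f g = 0) :
    f = 0 := by
  have h1 := h.coeFn_convL2 f (toL2 (h.involution f))
  rw [hf, groupConv_congr (f' := toL2 f) ae_eq_rfl (h.coeFn_involution f)] at h1
  have hm := (f.memLp_two.comp_measurePreserving (Measure.measurePreserving_inv μ)).star
  -- Continuity turns vanishing almost everywhere into vanishing at the identity, a point which may
  -- be null.
  have h2 : groupConv μ (toL2 f) (fun x => star (toL2 f x⁻¹)) = 0 :=
    (continuous_groupConv f.memLp_two hm).ae_eq_iff_eq μ continuous_zero |>.1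
      (h1.symm.trans (Lp.coeFn_zero _ _ _))
  refine toL2_injective ?_
  rw [map_zero, ← @inner_self_eq_zero ℂ, L2.inner_def]
  have h3 := congrFun h2 1
  simp only [groupConv, Pi.zero_apply] at h3
  rw [← h3]
  simp [RCLike.mul_conj]

/-- For an open set $U$ of small measure,
$\|f*1_U\|_2\le\|f\|_2\,\mu(U)=\|f\|_2\sqrt{\mu(U)}\,\|1_U\|_2$. So convolution operators are not
bounded below, and the scalar part of an operator $f*{\cdot}+t$ can be recovered. -/
theorem exists_norm_convL2_le (hG : ¬ DiscreteTopology G) (f : WeightedSpace p ω μ) {ε : ℝ}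
    (hε : 0 < ε) : ∃ g : Lp ℂ 2 μ, g ≠ 0 ∧ ‖h.convL2 f g‖ ≤ ε * ‖g‖ := by
  set δ : ℝ := (ε / (‖toL2 f‖ + 1)) ^ 2 with hδ
  have hδ0 : 0 < δ := by positivity
  obtain ⟨U, hUo, hUn, hU⟩ := exists_isOpen_measure_lt (μ := μ) hG
    (ε := ENNReal.ofReal δ) (by simpa using hδ0)
  have hUt : μ U ≠ ∞ := hU.ne_top
  set m := μ.real U with hm
  have hm0 : 0 < m := ENNReal.toReal_pos (hUo.measure_pos μ hUn).ne' hUt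
  have hmδ : m ≤ δ := by
    have := ENNReal.toReal_mono ENNReal.ofReal_ne_top hU.le
    rwa [ENNReal.toReal_ofReal hδ0.le] at this
  set g : Lp ℂ 2 μ := indicatorConstLp 2 hUo.measurableSet hUt (1 : ℂ) with hg
  have hgn : ‖g‖ = Real.sqrt m := by
    rw [hg, norm_indicatorConstLp two_ne_zero ENNReal.ofNat_ne_top, norm_one, one_mul,
      Real.sqrt_eq_rpow]
    simp [hm]
  have hg1 : eLpNorm g 1 μ = μ U := by
    rw [eLpNorm_congr_ae indicatorConstLp_coeFn, eLpNorm_one_eq_lintegral_enorm]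
    simp [enorm_indicator_eq_indicator_enorm, lintegral_indicator hUo.measurableSet]
  have hgm : MemLp g 1 μ := ⟨(Lp.memLp g).1, by rw [hg1]; exact hUt.lt_top⟩
  refine ⟨g, ?_, (h.norm_convL2_le_right f g hgm).trans ?_⟩
  · rw [← norm_pos_iff, hgn]
    exact Real.sqrt_pos.2 hm0
  · have hs : Real.sqrt m ≤ ε / (‖toL2 f‖ + 1) := by
      rw [← Real.sqrt_sq (show 0 ≤ ε / (‖toL2 f‖ + 1) by positivity)]
      exact Real.sqrt_le_sqrt hmδ
    rw [hg1, hgn]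
    calc ‖toL2 f‖ * (μ U).toReal = (‖toL2 f‖ * Real.sqrt m) * Real.sqrt m := by
          rw [mul_assoc, Real.mul_self_sqrt hm0.le]; rfl
      _ ≤ (‖toL2 f‖ * (ε / (‖toL2 f‖ + 1))) * Real.sqrt m := by gcongr
      _ ≤ ε * Real.sqrt m := by
        gcongr
        rw [← mul_div_assoc, div_le_iff₀ (by positivity)]
        nlinarith [norm_nonneg (toL2 f)]

theorem conv_add_left (f₁ f₂ g : WeightedSpace p ω μ) :
    conv hp h (f₁ + f₂) g = conv hp h f₁ g + conv hp h f₂ g :=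
  toL2_injective (by simp only [map_add, toL2_conv, convL2_add_left])

theorem conv_add_right (f g₁ g₂ : WeightedSpace p ω μ) :
    conv hp h f (g₁ + g₂) = conv hp h f g₁ + conv hp h f g₂ :=
  toL2_injective (by simp only [map_add, toL2_conv, convL2_add_right])

theorem conv_smul_left (c : ℂ) (f g : WeightedSpace p ω μ) :
    conv hp h (c • f) g = c • conv hp h f g :=
  toL2_injective (by simp only [map_smul, toL2_conv, convL2_smul_left])

theorem conv_smul_right (c : ℂ) (f g : WeightedSpace p ω μ) :
    conv hp h f (c • g) = c • conv hp h f g :=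
  toL2_injective (by simp only [map_smul, toL2_conv, convL2_smul_right])

theorem unitizedSpace_ext {a b : UnitizedSpace p ω μ} (h₁ : a.fst = b.fst) (h₂ : a.snd = b.snd) :
    a = b :=
  WithLp.ofLp_injective 1 (Prod.ext h₁ h₂)

theorem norm_unitizationMul_le (a b : UnitizedSpace p ω μ) :
    ‖(WithLp.toLp 1 (conv hp h a.fst b.fst + b.snd • a.fst + a.snd • b.fst, a.snd * b.snd) :
      UnitizedSpace p ω μ)‖ ≤ ((C + 1) * (2 * D) + 1) * ‖a‖ * ‖b‖ := by
  have h1 : ‖conv hp h a.fst b.fst‖ ≤ (C + 1) * (2 * D) * (‖a.fst‖ * ‖b.fst‖) := by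
    calc _ ≤ (C + 1) * (‖a.fst‖ * auxNorm σ b.fst + auxNorm σ a.fst * ‖b.fst‖) :=
          norm_conv_le hp h _ _
      _ ≤ (C + 1) * (‖a.fst‖ * (D * ‖b.fst‖) + (D * ‖a.fst‖) * ‖b.fst‖) := by
        gcongr
        · exact h.auxNorm_le_mul_norm _
        · exact h.auxNorm_le_mul_norm _
      _ = _ := by ring
  rw [UnitizedSpace.norm_def, UnitizedSpace.norm_def a, UnitizedSpace.norm_def b]
  have h2 : ‖conv hp h a.fst b.fst + b.snd • a.fst + a.snd • b.fst‖ ≤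
      (C + 1) * (2 * D) * (‖a.fst‖ * ‖b.fst‖) + ‖b.snd‖ * ‖a.fst‖ + ‖a.snd‖ * ‖b.fst‖ := by
    refine (norm_add₃_le).trans ?_
    rw [norm_smul, norm_smul]
    gcongr
  have h3 : ‖a.snd * b.snd‖ = ‖a.snd‖ * ‖b.snd‖ := norm_mul _ _
  refine (add_le_add h2 h3.le).trans ?_
  have h4 : 0 ≤ ((C : ℝ) + 1) * (2 * D) *
    (‖a.fst‖ * ‖b.snd‖ + ‖a.snd‖ * ‖b.fst‖ + ‖a.snd‖ * ‖b.snd‖) := by positivity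
  have h5 : 0 ≤ ‖a.fst‖ * ‖b.fst‖ := by positivity
  nlinarith only [h4, h5]

/-- The product of the unitization. -/
noncomputable def unitizationMul :
    UnitizedSpace p ω μ →L[ℂ] UnitizedSpace p ω μ →L[ℂ] UnitizedSpace p ω μ :=
  LinearMap.mkContinuous₂ (LinearMap.mk₂ ℂ
    (fun a b => WithLp.toLp 1
      (conv hp h a.fst b.fst + b.snd • a.fst + a.snd • b.fst, a.snd * b.snd))
    (fun a₁ a₂ b => by
      refine unitizedSpace_ext ?_ ?_
      · simp only [WithLp.add_fst, WithLp.add_snd, WithLp.toLp_fst, conv_add_left, smul_add,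
          add_smul]
        abel
      · simp only [WithLp.add_snd, WithLp.toLp_snd, add_mul])
    (fun c a b => by
      refine unitizedSpace_ext ?_ ?_
      · simp only [WithLp.smul_fst, WithLp.smul_snd, WithLp.toLp_fst,
          conv_smul_left, smul_add, smul_assoc,
          smul_comm c]
      · simp only [WithLp.smul_snd, WithLp.toLp_snd, smul_mul_assoc])
    (fun a b₁ b₂ => by
      refine unitizedSpace_ext ?_ ?_
      · simp only [WithLp.add_fst, WithLp.add_snd, WithLp.toLp_fst, conv_add_right, smul_add,
          add_smul]
        abel
      · simp only [WithLp.add_snd, WithLp.toLp_snd, mul_add])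
    (fun c a b => by
      refine unitizedSpace_ext ?_ ?_
      · simp only [WithLp.smul_fst, WithLp.smul_snd, WithLp.toLp_fst,
          conv_smul_right, smul_add, smul_assoc,
          smul_comm c]
      · simp only [WithLp.smul_snd, WithLp.toLp_snd, mul_smul_comm]))
    ((C + 1) * (2 * D) + 1) (norm_unitizationMul_le hp h)

theorem unitizationMul_apply (a b : UnitizedSpace p ω μ) :
    unitizationMul hp h a b = WithLp.toLp 1
      (conv hp h a.fst b.fst + b.snd • a.fst + a.snd • b.fst, a.snd * b.snd) := rfl

/-- The action of the unitization on `L^2(G)`. -/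
noncomputable def action : UnitizedSpace p ω μ →L[ℂ] Lp ℂ 2 μ →L[ℂ] Lp ℂ 2 μ :=
  LinearMap.mkContinuous₂ (LinearMap.mk₂ ℂ (fun a g => h.convL2 a.fst g + a.snd • g)
    (fun a₁ a₂ g => by
      simp only [WithLp.add_fst, WithLp.add_snd, convL2_add_left, add_smul]
      abel)
    (fun c a g => by
      simp only [WithLp.smul_fst, WithLp.smul_snd, convL2_smul_left, smul_add, smul_assoc])
    (fun a g₁ g₂ => by
      simp only [convL2_add_right, smul_add]
      abel)
    (fun c a g => by simp only [convL2_smul_right, smul_add, smul_comm c]))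
    (D + 1) (fun a g => by
      rw [LinearMap.mk₂_apply, UnitizedSpace.norm_def]
      calc ‖h.convL2 a.fst g + a.snd • g‖ ≤ (D * ‖a.fst‖) * ‖g‖ + ‖a.snd‖ * ‖g‖ := by
            refine (norm_add_le _ _).trans ?_
            rw [norm_smul]
            gcongr
            refine (h.norm_convL2_le _ _).trans ?_
            gcongr
            exact h.auxNorm_le_mul_norm _
        _ ≤ _ := by
            have : 0 ≤ (‖a.fst‖ + D * ‖a.snd‖) * ‖g‖ := by positivity
            nlinarith only [this])

theorem action_apply (a : UnitizedSpace p ω μ) (g : Lp ℂ 2 μ) :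
    h.action a g = h.convL2 a.fst g + a.snd • g := rfl

theorem norm_snd_le_norm_action (hG : ¬ DiscreteTopology G) (a : UnitizedSpace p ω μ) :
    ‖a.snd‖ ≤ ‖h.action a‖ := by
  refine le_of_forall_pos_le_add fun ε hε => ?_
  obtain ⟨g, hg0, hg⟩ := h.exists_norm_convL2_le hG a.fst hε
  have hg' : 0 < ‖g‖ := norm_pos_iff.2 hg0
  refine le_of_mul_le_mul_right ?_ hg'
  calc ‖a.snd‖ * ‖g‖ = ‖h.action a g - h.convL2 a.fst g‖ := by
        rw [action_apply, add_sub_cancel_left, norm_smul]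
    _ ≤ ‖h.action a‖ * ‖g‖ + ε * ‖g‖ :=
        (norm_sub_le _ _).trans (add_le_add ((h.action a).le_opNorm g) hg)
    _ = _ := by ring

theorem action_injective (hG : ¬ DiscreteTopology G) : Function.Injective h.action := by
  rw [injective_iff_map_eq_zero]
  intro a ha
  have h2 : a.snd = 0 := by
    have := h.norm_snd_le_norm_action hG a
    rwa [ha, norm_zero, norm_le_zero_iff] at this
  refine unitizedSpace_ext (h.eq_zero_of_convL2_eq_zero _ fun g => ?_) h2
  have := h.action_apply a g
  rw [ha, h2, zero_smul, add_zero] at this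
  exact this.symm

theorem action_mul (a b : UnitizedSpace p ω μ) :
    h.action (unitizationMul hp h a b) = h.action a * h.action b := by
  ext1 g
  rw [mul_apply_eq_comp, action_apply, action_apply, action_apply, unitizationMul_apply]
  simp only [WithLp.toLp_fst, WithLp.toLp_snd, convL2_add_left, convL2_smul_left,
    convL2_conv, convL2_add_right, convL2_smul_right,
    smul_add, mul_smul]
  abel

theorem action_one : h.action (WithLp.toLp 1 (0, 1)) = 1 := by
  ext1 g
  rw [action_apply]
  have : h.convL2 0 g = 0 := by simpa using h.convL2_smul_left 0 0 g
  simp [this]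

/-- The unitization of `L^p(G,ω) ∩ L^2(G)` as a Banach algebra. -/
noncomputable def unitization (hG : ¬ DiscreteTopology G) :
    UnitalBanachAlgebra (UnitizedSpace p ω μ) where
  mul := unitizationMul hp h
  one := WithLp.toLp 1 (0, 1)
  -- The algebra laws are inherited from composition of operators, the action being faithful.
  mul_assoc a b c := h.action_injective hG (by simp only [action_mul, mul_assoc])
  one_mul a := h.action_injective hG (by rw [action_mul, action_one, one_mul])
  mul_one a := h.action_injective hG (by rw [action_mul, action_one, mul_one])
  complete := by
    have : CompleteSpace (WeightedSpace p ω μ) := WeightedSpace.completeSpace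
    infer_instance

theorem isConvolutionUnitization (hG : ¬ DiscreteTopology G) :
    IsConvolutionUnitization (unitization hp h hG) :=
  ⟨rfl, fun a b => ⟨conv hp h a.fst b.fst, h.isConvolution_convL2 _ _, rfl⟩⟩

/-- The embedding of the unitization in `B(L^2(G))`. -/
noncomputable def embedding (hG : ¬ DiscreteTopology G) :
    (unitization hp h hG).Embedding (Lp ℂ 2 μ →L[ℂ] Lp ℂ 2 μ) where
  toCLM := h.action
  injective := h.action_injective hG
  map_mul := action_mul hp h
  map_one := h.action_one

theorem isConvolutionAction (hG : ¬ DiscreteTopology G) :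
    IsConvolutionAction (embedding hp h hG) :=
  fun a g => ⟨h.convL2 a.fst g, h.isConvolution_convL2 _ _, rfl⟩

/-- The involution of the unitization. -/
noncomputable def unitizationInvolution (a : UnitizedSpace p ω μ) : UnitizedSpace p ω μ :=
  WithLp.toLp 1 (h.involution a.fst, star a.snd)

theorem norm_unitizationInvolution (a : UnitizedSpace p ω μ) :
    ‖h.unitizationInvolution a‖ = ‖a‖ := by
  rw [UnitizedSpace.norm_def, UnitizedSpace.norm_def]
  simp only [unitizationInvolution, WithLp.toLp_fst, WithLp.toLp_snd, norm_involution, norm_star]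

theorem action_unitizationInvolution (a : UnitizedSpace p ω μ) :
    h.action (h.unitizationInvolution a) = ContinuousLinearMap.adjoint (h.action a) := by
  rw [ContinuousLinearMap.eq_adjoint_iff]
  intro k g
  rw [action_apply, action_apply, inner_add_left, inner_add_right, inner_smul_left,
    inner_smul_right]
  simp only [unitizationInvolution, WithLp.toLp_fst, WithLp.toLp_snd, inner_convL2_involution]
  simp

/-- In $(f*f+2tf,t^2)$ the first term is interpolated, and the others carry a factor
$|t|\le\|a\|_{op}$. -/
theorem norm_unitizationMul_self_le (hG : ¬ DiscreteTopology G) (a : UnitizedSpace p ω μ) :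
    ‖unitizationMul hp h a a‖ ≤
      ((C + 1) * (2 * D)) * ‖a‖ ^ (1 + θ) * ‖toL2 a.fst‖ ^ (1 - θ) + 2 * ‖h.action a‖ * ‖a‖ := by
  have hθ := h.exponent_pos
  have hs := h.norm_snd_le_norm_action hG a
  have hf : ‖a.fst‖ ≤ ‖a‖ := by
    rw [UnitizedSpace.norm_def]; exact le_add_of_nonneg_right (norm_nonneg _)
  have h1 : ‖conv hp h a.fst a.fst‖ ≤
      ((C + 1) * (2 * D)) * ‖a‖ ^ (1 + θ) * ‖toL2 a.fst‖ ^ (1 - θ) := by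
    have hx : auxNorm σ a.fst ≤ D * ‖a‖ ^ θ * ‖toL2 a.fst‖ ^ (1 - θ) :=
      (h.auxNorm_le a.fst).trans (by gcongr)
    have hx0 : 0 ≤ auxNorm σ a.fst := ENNReal.toReal_nonneg
    calc _ ≤ (C + 1) * (‖a.fst‖ * auxNorm σ a.fst + auxNorm σ a.fst * ‖a.fst‖) :=
          norm_conv_le hp h _ _
      _ = (C + 1) * 2 * (‖a.fst‖ * auxNorm σ a.fst) := by ring
      _ ≤ (C + 1) * 2 * (‖a‖ * (D * ‖a‖ ^ θ * ‖toL2 a.fst‖ ^ (1 - θ))) := by gcongr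
      _ = _ := by
        rw [Real.rpow_add_of_nonneg (norm_nonneg a) zero_le_one hθ.le, Real.rpow_one]
        ring
  rw [unitizationMul_apply, UnitizedSpace.norm_def]
  have h2 : ‖conv hp h a.fst a.fst + a.snd • a.fst + a.snd • a.fst‖ ≤
      ((C + 1) * (2 * D)) * ‖a‖ ^ (1 + θ) * ‖toL2 a.fst‖ ^ (1 - θ) +
        ‖h.action a‖ * ‖a.fst‖ + ‖h.action a‖ * ‖a.fst‖ := by
    refine (norm_add₃_le).trans ?_
    rw [norm_smul]
    gcongr
  have h3 : ‖a.snd * a.snd‖ ≤ ‖h.action a‖ * ‖a.snd‖ := by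
    rw [norm_mul]; gcongr
  refine (add_le_add h2 h3).trans ?_
  have h4 : 2 * ‖h.action a‖ * ‖a‖ = 2 * ‖h.action a‖ * (‖a.fst‖ + ‖a.snd‖) := by
    rw [UnitizedSpace.norm_def]
  rw [h4]
  nlinarith only [mul_nonneg (norm_nonneg (h.action a)) (norm_nonneg a.snd)]

/-- The function part of $a^2$ is $a$ acting on $f$, plus $tf$; each term is at most
$\|a\|_{op}\|f\|_2$. -/
theorem norm_toL2_unitizationMul_self_le (hG : ¬ DiscreteTopology G) (a : UnitizedSpace p ω μ) :
    ‖toL2 (unitizationMul hp h a a).fst‖ ≤ 2 * ‖h.action a‖ * ‖toL2 a.fst‖ := by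
  have e : toL2 (unitizationMul hp h a a).fst =
      h.action a (toL2 a.fst) + a.snd • toL2 a.fst := by
    rw [unitizationMul_apply, action_apply]
    simp only [WithLp.toLp_fst, map_add, map_smul, toL2_conv]
  rw [e]
  refine (norm_add_le _ _).trans ?_
  rw [norm_smul]
  have h1 := (h.action a).le_opNorm (toL2 a.fst)
  have h2 := mul_le_mul_of_nonneg_right (h.norm_snd_le_norm_action hG a)
    (norm_nonneg (toL2 a.fst))
  linarith

theorem admitsNormControlledInversion (hG : ¬ DiscreteTopology G) :
    (embedding hp h hG).AdmitsNormControlledInversion := by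
  refine UnitalBanachAlgebra.Embedding.admitsNormControlledInversion_of_decay _
    h.unitizationInvolution h.action_unitizationInvolution
    (fun a => (h.norm_unitizationInvolution a).le) fun M ρ ε hρ hε => ?_
  -- The given `M` and `ρ` are arbitrary reals; the maxima make them nonnegative and positive
  -- respectively.
  obtain ⟨k, hk⟩ := exists_forall_le_of_recurrence (C := (C + 1) * (2 * D)) (θ := θ)
    (M := max M 0) (ρ := max ρ (1 / 2)) (ε := ε) (by positivity) h.exponent_pos
    h.exponent_lt_one (le_max_right _ _) (lt_max_of_lt_right (by norm_num))
    (max_lt hρ (by norm_num)) hε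
  refine ⟨k, fun b hb hbρ => ?_⟩
  change ‖h.action b‖ ≤ ρ at hbρ
  set sq : UnitizedSpace p ω μ → UnitizedSpace p ω μ := fun c => unitizationMul hp h c c with hsq
  have hs : ∀ j, sq^[j + 1] b = unitizationMul hp h (sq^[j] b) (sq^[j] b) := fun j =>
    Function.iterate_succ_apply' _ _ _
  have hop : ∀ j, ‖h.action (sq^[j] b)‖ ≤ max ρ (1 / 2) ^ 2 ^ j := fun j => by
    induction j with
    | zero => simpa using Or.inl hbρ
    | succ j ih =>
      rw [hs, action_mul, pow_succ 2 j, pow_mul, pow_two]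
      exact (norm_mul_le _ _).trans (by gcongr)
  have hf : ‖b.fst‖ ≤ ‖b‖ := by
    rw [UnitizedSpace.norm_def]; exact le_add_of_nonneg_right (norm_nonneg _)
  refine hk (fun j => ‖sq^[j] b‖) (fun j => ‖toL2 (sq^[j] b).fst‖) (fun _ => norm_nonneg _)
    (fun _ => norm_nonneg _) (hb.trans (le_max_left _ _))
    (((norm_toL2_le _).trans hf).trans (hb.trans (le_max_left _ _))) (fun j => ?_) (fun j => ?_)
  · simp only [hs]
    refine (norm_toL2_unitizationMul_self_le hp h hG _).trans ?_
    gcongr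
    exact hop j
  · simp only [hs]
    refine (norm_unitizationMul_self_le hp h hG _).trans ?_
    gcongr
    exact hop j

end Algebra

end IsControlledWeight

/-! ### Unimodularity from subexponential growth -/

section Unimodular

variable {G : Type*} [Group G] [TopologicalSpace G] [IsTopologicalGroup G]
  [LocallyCompactSpace G] [MeasurableSpace G] [BorelSpace G]
  {μ : Measure G} [μ.IsHaarMeasure] [μ.Regular]

open Measure Filter

theorem map_mul_right_pow_eq {g : G} {c : ℝ≥0} (hc : map (· * g) μ = c • μ) (n : ℕ) :
    map (· * g ^ n) μ = c ^ n • μ := by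
  induction n with
  | zero => simp
  | succ n ih =>
    have e : (fun x : G => x * g ^ (n + 1)) = (· * g) ∘ (· * g ^ n) := by
      funext x
      simp [pow_succ, mul_assoc]
    rw [e, ← map_map (measurable_mul_const _) (measurable_mul_const _), ih, Measure.map_smul, hc,
      smul_smul, pow_succ]

theorem le_one_of_pow_le {c : ℝ≥0}
    (h : ∀ ε : ℝ, 0 < ε → ∃ K : ℝ, ∀ n : ℕ, 1 ≤ n → (c : ℝ) ^ n ≤ K * Real.exp (ε * n)) :
    c ≤ 1 := by
  by_contra! hc
  have hc1 : (1 : ℝ) < c := by exact_mod_cast hc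
  have hl : 0 < Real.log c := Real.log_pos hc1
  obtain ⟨K, hK⟩ := h (Real.log c / 2) (by positivity)
  have h1 : Tendsto (fun n : ℕ => Real.exp (Real.log c / 2 * n)) atTop atTop :=
    Real.tendsto_exp_atTop.comp (tendsto_natCast_atTop_atTop.const_mul_atTop (by positivity))
  obtain ⟨n, hn1, hn⟩ := ((h1.eventually_gt_atTop K).and (eventually_ge_atTop 1)).exists
  have h2 := hK n hn
  have h3 : (c : ℝ) ^ n = Real.exp (Real.log c / 2 * n) * Real.exp (Real.log c / 2 * n) := by
    rw [← Real.exp_add, ← add_mul, add_halves, mul_comm, Real.exp_nat_mul,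
      Real.exp_log (by linarith)]
  rw [h3] at h2
  exact absurd (le_of_mul_le_mul_right h2 (Real.exp_pos _)) (not_le.2 hn1)

/-- A group in which right translates of sets grow subexponentially is unimodular. -/
theorem isInvInvariant_of_subexponential (hE : ∀ g : G, ∃ E : Set G, MeasurableSet E ∧ μ E ≠ 0 ∧
    μ E ≠ ∞ ∧ ∀ ε : ℝ, 0 < ε → ∃ C : ℝ, ∀ n : ℕ, 1 ≤ n →
      μ ((fun x => x * g ^ n) ⁻¹' E) ≤ ENNReal.ofReal (C * Real.exp (ε * n))) :
    μ.IsInvInvariant := by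
  have hc : ∀ g : G, ∃ c : ℝ≥0, map (· * g) μ = c • μ := fun g => by
    have : (map (· * g) μ).Regular := Regular.map (Homeomorph.mulRight g)
    exact ⟨_, isMulLeftInvariant_eq_smul_of_regular _ μ⟩
  choose c hc using hc
  have hc1 : ∀ g, c g ≤ 1 := fun g => by
    obtain ⟨E, hEm, hE0, hEt, hE⟩ := hE g
    refine le_one_of_pow_le fun ε hε => ?_
    obtain ⟨C, hC⟩ := hE ε hε
    have hE0' : 0 < (μ E).toReal := ENNReal.toReal_pos hE0 hEt
    refine ⟨max C 0 / (μ E).toReal, fun n hn => ?_⟩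
    have h1 := hC n hn
    rw [← map_apply (measurable_mul_const _) hEm, map_mul_right_pow_eq (hc g)] at h1
    have h2 := ENNReal.toReal_mono ENNReal.ofReal_ne_top (h1.trans (ENNReal.ofReal_le_ofReal
      (mul_le_mul_of_nonneg_right (le_max_left C 0) (Real.exp_pos _).le)))
    rw [ENNReal.toReal_ofReal (by positivity), Measure.smul_apply, ENNReal.smul_def, smul_eq_mul,
      ENNReal.toReal_mul, ENNReal.coe_toReal, NNReal.coe_pow] at h2
    rw [div_mul_eq_mul_div, le_div_iff₀ hE0']
    exact h2
  obtain ⟨V, hVc, hV1⟩ := exists_compact_mem_nhds (1 : G)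
  obtain ⟨U, hUV, hUo, h1U⟩ := mem_nhds_iff.1 hV1
  have hUt : μ U ≠ ∞ := ((measure_mono hUV).trans_lt hVc.measure_lt_top).ne
  have hU0 : ∀ W : Set G, IsOpen W → 1 ∈ W → μ W ≠ 0 :=
    fun W hW h1 => (hW.measure_pos μ ⟨1, h1⟩).ne'
  -- The modular factor is multiplicative, so $c(g)c(g^{-1})=1$; as both are at most 1, both equal
  -- 1.
  have hr : μ.IsMulRightInvariant := ⟨fun g => by
    have h1 : c g * c g⁻¹ = 1 := by
      have e : (c g * c g⁻¹) • μ = μ := by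
        calc (c g * c g⁻¹) • μ = map (· * g⁻¹) (map (· * g) μ) := by
              rw [hc g, Measure.map_smul, hc, smul_smul]
          _ = μ := by
              rw [map_map (measurable_mul_const _) (measurable_mul_const _)]
              simp [Function.comp_def]
      have e2 := congrArg (fun m : Measure G => m U) e
      simp only [Measure.smul_apply, ENNReal.smul_def, smul_eq_mul] at e2
      have : ((c g * c g⁻¹ : ℝ≥0) : ℝ≥0∞) = 1 := by
        rw [← ENNReal.mul_left_inj (hU0 U hUo h1U) hUt, e2, one_mul]
      exact_mod_cast this
    have h2 : c g = 1 := by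
      refine le_antisymm (hc1 g) ?_
      rw [← h1]
      exact mul_le_of_le_one_right zero_le (hc1 _)
    rw [hc, h2, one_smul]⟩
  have : μ.inv.Regular := Regular.map (Homeomorph.inv G)
  have hi := isMulLeftInvariant_eq_smul_of_regular μ.inv μ
  set k := haarScalarFactor μ.inv μ
  -- A symmetric open set of finite positive measure shows that the factor between $\mu$ and its
  -- image under inversion is 1.
  have hW : IsOpen (U ∩ U⁻¹) := hUo.inter hUo.inv
  have hk : ((k : ℝ≥0) : ℝ≥0∞) = 1 := by
    have e2 := congrArg (fun m : Measure G => m (U ∩ U⁻¹)) hi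
    simp only [Measure.smul_apply, ENNReal.smul_def, smul_eq_mul, Measure.inv_apply, Set.inter_inv,
      inv_inv, Set.inter_comm U⁻¹ U] at e2
    rw [← ENNReal.mul_left_inj (hU0 _ hW ⟨h1U, by simpa using h1U⟩)
      ((measure_mono Set.inter_subset_left).trans_lt hUt.lt_top).ne, ← e2, one_mul]
  refine ⟨?_⟩
  have hk' : k = 1 := by exact_mod_cast hk
  rw [hi, hk', one_smul]

end Unimodular

/-! ### Word length and powers of generating neighbourhoods -/

namespace IsGeneratingNhd

section Top

variable {G : Type*} [Group G] [TopologicalSpace G] {U V : Set G}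

theorem one_mem (hU : IsGeneratingNhd U) : (1 : G) ∈ U := mem_of_mem_nhds hU.mem_nhds

theorem pow_mono (hU : IsGeneratingNhd U) {m n : ℕ} (h : m ≤ n) : U ^ m ⊆ U ^ n :=
  Set.pow_subset_pow_right hU.one_mem h

theorem pow_inv_eq (hU : IsGeneratingNhd U) (n : ℕ) : (U ^ n)⁻¹ = U ^ n := by
  rw [← inv_pow, hU.inv_eq]

theorem exists_mem_pow (hU : IsGeneratingNhd U) (x : G) : ∃ n, x ∈ U ^ n := by
  have hx : x ∈ Subgroup.closure U := hU.closure_eq_top ▸ Subgroup.mem_top x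
  induction hx using Subgroup.closure_induction with
  | mem x hx => exact ⟨1, by simpa using hx⟩
  | one => exact ⟨0, by simp⟩
  | mul x y _ _ hx hy =>
    obtain ⟨m, hm⟩ := hx
    obtain ⟨n, hn⟩ := hy
    exact ⟨m + n, by rw [pow_add]; exact Set.mul_mem_mul hm hn⟩
  | inv x _ hx =>
    obtain ⟨m, hm⟩ := hx
    exact ⟨m, by rw [← hU.pow_inv_eq]; simpa using hm⟩

theorem lengthFun_le_iff (hU : IsGeneratingNhd U) {x : G} {n : ℕ} :
    lengthFun U x ≤ n ↔ x ∈ U ^ n :=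
  ⟨fun h => hU.pow_mono h (Nat.sInf_mem (hU.exists_mem_pow x)), fun h => Nat.sInf_le h⟩

theorem lengthFun_mul_le (hU : IsGeneratingNhd U) (x y : G) :
    lengthFun U (x * y) ≤ lengthFun U x + lengthFun U y := by
  rw [hU.lengthFun_le_iff, pow_add]
  exact Set.mul_mem_mul (hU.lengthFun_le_iff.1 le_rfl) (hU.lengthFun_le_iff.1 le_rfl)

theorem lengthFun_inv (hU : IsGeneratingNhd U) (x : G) : lengthFun U x⁻¹ = lengthFun U x := by
  refine eq_of_forall_ge_iff fun n => ?_
  rw [hU.lengthFun_le_iff, hU.lengthFun_le_iff, ← Set.mem_inv, hU.pow_inv_eq]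

variable [IsTopologicalGroup G]

theorem isCompact_pow (hU : IsGeneratingNhd U) (n : ℕ) : IsCompact (U ^ n) := by
  induction n with
  | zero => simp
  | succ n ih => rw [pow_succ]; exact ih.mul hU.isCompact

theorem sigmaCompactSpace (hU : IsGeneratingNhd U) : SigmaCompactSpace G :=
  ⟨⟨fun n => U ^ n, hU.isCompact_pow, Set.eq_univ_of_forall fun x =>
    Set.mem_iUnion.2 (hU.exists_mem_pow x)⟩⟩

/-- The interiors of the powers of `V` increase to cover the compact set `U`. Hence growth bounds
for one generating neighbourhood pass to any other, after rescaling the exponent. -/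
theorem exists_pow_subset (hU : IsGeneratingNhd U) (hV : IsGeneratingNhd V) :
    ∃ m, 1 ≤ m ∧ ∀ n, U ^ n ⊆ V ^ (m * n) := by
  have hcov : U ⊆ ⋃ n : ℕ, interior (V ^ n) := fun x _ => by
    obtain ⟨n, hn⟩ := hV.exists_mem_pow x
    refine Set.mem_iUnion.2 ⟨n + 1, mem_interior_iff_mem_nhds.2 ?_⟩
    rw [pow_succ]
    have : x • V ∈ 𝓝 (x • (1 : G)) := smul_mem_nhds_smul x hV.mem_nhds
    rw [smul_eq_mul, mul_one] at this
    exact Filter.mem_of_superset this (Set.smul_set_subset_mul hn)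
  obtain ⟨m, hm⟩ := hU.isCompact.elim_directed_cover _ (fun n => isOpen_interior) hcov
    (Monotone.directed_le fun a b hab => interior_mono (hV.pow_mono hab))
  refine ⟨m + 1, by omega, fun n => ?_⟩
  rw [pow_mul]
  exact Set.pow_subset_pow_left ((hm.trans interior_subset).trans (hV.pow_mono (by omega)))

end Top

section Measure

variable {G : Type*} [Group G] [TopologicalSpace G] [IsTopologicalGroup G] [T2Space G]
  [MeasurableSpace G] [BorelSpace G] {U V : Set G} {μ : Measure G}

theorem measurableSet_pow (hU : IsGeneratingNhd U) (n : ℕ) : MeasurableSet (U ^ n) :=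
  (hU.isCompact_pow n).measurableSet

theorem measurable_lengthFun (hU : IsGeneratingNhd U) : Measurable (lengthFun U) := by
  refine measurable_of_Iic fun n => ?_
  have : lengthFun U ⁻¹' Set.Iic n = U ^ n := by
    ext x
    simp [hU.lengthFun_le_iff]
  rw [this]
  exact hU.measurableSet_pow n

/-- A decomposition into layers over the balls $U^n$, so that only measures of balls, not of
spheres, are needed. -/
theorem lintegral_lengthFun_le (hU : IsGeneratingNhd U) (φ a : ℕ → ℝ≥0∞)
    (h : ∀ m, φ m ≤ ∑' n, if m ≤ n then a n else 0) :
    ∫⁻ x, φ (lengthFun U x) ∂μ ≤ ∑' n, a n * μ (U ^ n) := by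
  calc ∫⁻ x, φ (lengthFun U x) ∂μ ≤ ∫⁻ x, ∑' n, (U ^ n).indicator (fun _ => a n) x ∂μ := by
        refine lintegral_mono fun x => (h _).trans_eq (tsum_congr fun n => ?_)
        by_cases hn : x ∈ U ^ n
        · rw [Set.indicator_of_mem hn, if_pos (hU.lengthFun_le_iff.2 hn)]
        · rw [Set.indicator_of_notMem hn, if_neg (mt hU.lengthFun_le_iff.1 hn)]
    _ = ∑' n, a n * μ (U ^ n) := by
        rw [lintegral_tsum fun n =>
          (measurable_const.indicator (hU.measurableSet_pow n)).aemeasurable]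
        refine tsum_congr fun n => ?_
        rw [lintegral_indicator_const (hU.measurableSet_pow n)]

variable [LocallyCompactSpace G] [μ.IsHaarMeasure] [μ.Regular]

theorem isInvInvariant (hU : IsGeneratingNhd U) (hg : ∀ ε : ℝ, 0 < ε → ∃ C : ℝ, ∀ n : ℕ, 1 ≤ n →
      μ (U ^ n) ≤ ENNReal.ofReal (C * Real.exp (ε * n))) : μ.IsInvInvariant := by
  refine isInvInvariant_of_subexponential fun g => ⟨U, hU.isCompact.measurableSet,
    (Measure.measure_pos_of_mem_nhds μ hU.mem_nhds).ne', hU.isCompact.measure_lt_top.ne,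
    fun ε hε => ?_⟩
  obtain ⟨k, hk⟩ := hU.exists_mem_pow g
  -- Passing to $k+1$ gives a positive divisor for $\varepsilon$. Since $Ug^{-n}\subseteq
  -- U^{1+(k+1)n}$, the rate $\varepsilon/(k+1)$ becomes $\varepsilon$ per step.
  replace hk : g⁻¹ ∈ U ^ (k + 1) := by
    rw [← hU.pow_inv_eq, Set.inv_mem_inv]
    exact hU.pow_mono (Nat.le_succ k) hk
  obtain ⟨C, hC⟩ := hg (ε / (k + 1)) (by positivity)
  refine ⟨C * Real.exp (ε / (k + 1)), fun n hn => ?_⟩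
  have hsub : (fun x => x * g ^ n) ⁻¹' U ⊆ U ^ (1 + (k + 1) * n) := fun x hx => by
    have : x = x * g ^ n * g⁻¹ ^ n := by simp
    rw [this, pow_add, pow_one, pow_mul]
    exact Set.mul_mem_mul hx (Set.pow_mem_pow hk)
  refine (measure_mono hsub).trans ((hC _ (by omega)).trans_eq ?_)
  rw [mul_assoc, ← Real.exp_add]
  congr 3
  push_cast
  field_simp

end Measure

end IsGeneratingNhd

/-! ### Interpolation and the criterion for controlled weights -/

section Interpolation

variable {α : Type*} [MeasurableSpace α] {μ : Measure α}

/-- Interpolation of the norm of `L¹(ω^γ)` between those of `L^p(ω)` and `L²`. -/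
theorem eLpNorm_one_weight_le {p : ℝ≥0∞} (hp1 : 1 ≤ p) (hp : p ≠ ∞) {ω : α → ℝ}
    (hω : Measurable ω) (hω1 : ∀ x, 1 ≤ ω x) {γ θ κ s : ℝ} (hθ0 : 0 ≤ θ) (hθ1 : θ ≤ 1)
    (hκ : 0 ≤ κ) (hsum : θ / p.toReal + (1 - θ) / 2 + κ = 1) (hγ : γ ≤ θ - s * κ)
    {f : α → ℂ} (hf : AEStronglyMeasurable f μ) :
    eLpNorm (fun x => ((ω x ^ γ : ℝ) : ℂ) * f x) 1 μ ≤
      (∫⁻ x, ENNReal.ofReal (ω x) ^ (-s) ∂μ) ^ κ * eLpNorm (fun x => (ω x : ℂ) * f x) p μ ^ θ *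
        eLpNorm f 2 μ ^ (1 - θ) := by
  have hp0 : p ≠ 0 := (zero_lt_one.trans_le hp1).ne'
  have hP0 : 0 < p.toReal := ENNReal.toReal_pos hp0 hp
  have h1θ : 0 ≤ 1 - θ := by linarith
  have hmω : AEMeasurable (fun x => ENNReal.ofReal (ω x)) μ := hω.ennreal_ofReal.aemeasurable
  have hn : ∀ r : ℝ, 0 ≤ r → ‖(r : ℂ)‖ₑ = ENNReal.ofReal r := fun r hr => by
    rw [← ofReal_norm, Complex.norm_real, Real.norm_of_nonneg hr]
  -- Hölder's inequality for
  -- $\omega^\gamma|f|\le(\omega|f|)^\theta\cdot|f|^{1-\theta}\cdot\omega^{-s\kappa}$, with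
  -- exponents $\theta/p$, $(1-\theta)/2$ and $\kappa$ adding up to 1.
  have key := ENNReal.lintegral_prod_norm_pow_le (μ := μ) Finset.univ
    (f := ![fun x => (ENNReal.ofReal (ω x) * ‖f x‖ₑ) ^ p.toReal, fun x => ‖f x‖ₑ ^ (2 : ℝ),
      fun x => ENNReal.ofReal (ω x) ^ (-s)]) (p := ![θ / p.toReal, (1 - θ) / 2, κ])
    (fun i _ => by
      fin_cases i
      · exact (hmω.mul hf.enorm).pow_const _
      · exact hf.enorm.pow_const _
      · exact hmω.pow_const _)
    (by simpa [Fin.sum_univ_three] using hsum)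
    (fun i _ => by
      fin_cases i
      · exact div_nonneg hθ0 hP0.le
      · exact div_nonneg h1θ two_pos.le
      · exact hκ)
  simp only [Fin.prod_univ_three, Matrix.cons_val_zero, Matrix.cons_val_one, Matrix.cons_val]
    at key
  have hA : eLpNorm (fun x => (ω x : ℂ) * f x) p μ ^ θ =
      (∫⁻ x, (ENNReal.ofReal (ω x) * ‖f x‖ₑ) ^ p.toReal ∂μ) ^ (θ / p.toReal) := by
    rw [eLpNorm_eq_lintegral_rpow_enorm_toReal hp0 hp, ← ENNReal.rpow_mul, one_div_mul_eq_div]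
    simp only [enorm_mul, hn _ (zero_le_one.trans (hω1 _))]
  have hB : eLpNorm f 2 μ ^ (1 - θ) = (∫⁻ x, ‖f x‖ₑ ^ (2 : ℝ) ∂μ) ^ ((1 - θ) / 2) := by
    rw [eLpNorm_eq_lintegral_rpow_enorm_toReal two_ne_zero ENNReal.ofNat_ne_top,
      ← ENNReal.rpow_mul, one_div_mul_eq_div]
    simp
  rw [eLpNorm_one_eq_lintegral_enorm, hA, hB]
  refine (lintegral_mono fun x => ?_).trans (key.trans_eq (by ring))
  have hW1 : 1 ≤ ENNReal.ofReal (ω x) := by simpa using ENNReal.ofReal_le_ofReal (hω1 x)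
  have hW0 : ENNReal.ofReal (ω x) ≠ 0 := (zero_lt_one.trans_le hW1).ne'
  have hω0 : 0 < ω x := zero_lt_one.trans_le (hω1 x)
  rw [enorm_mul, hn _ (by positivity), ← ENNReal.ofReal_rpow_of_pos hω0, ← ENNReal.rpow_mul,
    ← ENNReal.rpow_mul, ← ENNReal.rpow_mul, mul_div_cancel₀ _ hP0.ne',
    mul_div_cancel₀ _ (two_ne_zero' ℝ), ENNReal.mul_rpow_of_nonneg _ _ hθ0]
  calc ENNReal.ofReal (ω x) ^ γ * ‖f x‖ₑ
      ≤ ENNReal.ofReal (ω x) ^ (θ + -s * κ) * (‖f x‖ₑ ^ (θ + (1 - θ))) := by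
        gcongr
        · linarith
        · simp
    _ = _ := by
        rw [ENNReal.rpow_add _ _ hW0 ENNReal.ofReal_ne_top, ENNReal.rpow_add_of_nonneg _ _ hθ0 h1θ]
        ring

end Interpolation

theorem ENNReal.HolderConjugate.toReal_inv_eq {p q : ℝ≥0∞} (hpq : p.HolderConjugate q) :
    (q⁻¹).toReal = 1 - 1 / p.toReal := by
  have h := hpq.inv_add_inv_eq_one
  have h1 : p⁻¹ ≠ ∞ := ne_top_of_le_ne_top ENNReal.one_ne_top (h ▸ le_self_add)
  have h2 : q⁻¹ ≠ ∞ := ne_top_of_le_ne_top ENNReal.one_ne_top (h ▸ le_add_self)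
  have := congrArg ENNReal.toReal h
  rw [ENNReal.toReal_add h1 h2, ENNReal.toReal_inv, ENNReal.toReal_one] at this
  rw [one_div]
  linarith

/-- A symmetric weight `ω` with `ω(xy) ≤ C (ω(x) ω(y)^γ + ω(x)^γ ω(y))` is controlled by `ω^γ` if
`1/ω` is in `L^s` for some `s < (1 - γ) q`. -/
theorem exists_isControlledWeight {G : Type*} [Group G] [MeasurableSpace G] {μ : Measure G}
    {p q : ℝ≥0∞} (hp1 : 1 ≤ p) (hp : p ≠ ∞) (hpq : p.HolderConjugate q) {ω : G → ℝ}
    (hω : Measurable ω) (hω1 : ∀ x, 1 ≤ ω x) (hinv : ∀ x, ω x⁻¹ = ω x) {γ s : ℝ} (hγ0 : 0 ≤ γ)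
    (C : ℝ≥0) (hmul : ∀ x y, ω (x * y) ≤ C * (ω x * ω y ^ γ + ω x ^ γ * ω y))
    (hs0 : 0 < s) (hs : s * (q⁻¹).toReal < 1 - γ)
    (hint : ∫⁻ x, ENNReal.ofReal (ω x) ^ (-s) ∂μ ≠ ∞) :
    ∃ D θ, IsControlledWeight μ p ω (fun x => ω x ^ γ) C D θ := by
  have hP1 : 1 ≤ p.toReal := by simpa using ENNReal.toReal_mono hp hp1
  have hQ := hpq.toReal_inv_eq
  set Q := (q⁻¹).toReal with hQdef
  have hQ0 : 0 ≤ Q := ENNReal.toReal_nonneg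
  set P := p.toReal with hP
  have hP0 : P⁻¹ = 1 - Q := by rw [hQ, one_div]; ring
  set δ := 1 - γ - s * Q with hδ
  have hδ0 : 0 < δ := by linarith
  have hδ1 : δ ≤ 1 := by nlinarith [mul_nonneg hs0.le hQ0]
  -- Take $\theta=1-\eta$. As $\eta\to0$ the third Hölder exponent tends to $1/q$, so the slack
  -- $\delta=1-\gamma-s/q$ leaves room for a small positive $\eta$.
  set η := δ / (2 * (1 + s)) with hη
  have hη0 : 0 < η := by positivity
  have hη' : η * (2 * (1 + s)) = δ := by rw [hη]; field_simp
  have hη1 : η ≤ 1 / 2 := by nlinarith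
  set κ := 1 - (1 - η) / P - (1 - (1 - η)) / 2 with hκ
  have hκ' : κ = (1 - η) * Q + η / 2 := by rw [hκ, div_eq_mul_inv, hP0]; ring
  have hκ0 : 0 ≤ κ := by
    rw [hκ']
    have : 0 ≤ 1 - η := by linarith
    positivity
  refine ⟨((∫⁻ x, ENNReal.ofReal (ω x) ^ (-s) ∂μ) ^ κ).toNNReal, 1 - η, hω, hω.pow_const _, hω1,
    fun x => Real.one_le_rpow (hω1 x) hγ0, hinv, hmul, by linarith, by linarith, fun f hf => ?_⟩
  rw [ENNReal.coe_toNNReal (ENNReal.rpow_lt_top_of_nonneg hκ0 hint).ne]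
  refine eLpNorm_one_weight_le hp1 hp hω hω1 (by linarith) (by linarith) hκ0 (by rw [hκ]; ring)
    ?_ hf
  rw [hκ']
  nlinarith [mul_nonneg (mul_nonneg hs0.le hη0.le) hQ0]

/-! ### Step weights as functions of the subgroup level -/

section StepWeight

variable {G : Type*} [Group G] {K : ℕ → Subgroup G}

/-- The least `i` with `x ∈ K i`. -/
noncomputable def subgroupLevel (K : ℕ → Subgroup G) (x : G) : ℕ := sInf {i | x ∈ K i}

theorem subgroupLevel_le_iff (hK : Monotone K) (hx : ∀ x, ∃ i, x ∈ K i) {x : G} {i : ℕ} :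
    subgroupLevel K x ≤ i ↔ x ∈ K i :=
  ⟨fun h => hK h (Nat.sInf_mem (hx x)), fun h => Nat.sInf_le h⟩

/-- The value of the weight `1 + ∑ i, n i • 1_{K (i+1) \ K i}` on `K i \ K (i-1)`. -/
def stepValue (n : ℕ → ℝ) : ℕ → ℝ
  | 0 => 1
  | i + 1 => 1 + n i

theorem stepWeight_eq (hK : Monotone K) (hx : ∀ x, ∃ i, x ∈ K i) (n : ℕ → ℝ) (x : G) :
    stepWeight K n x = stepValue n (subgroupLevel K x) := by
  have hmem : ∀ i, x ∈ ((K (i + 1) : Set G) \ (K i : Set G)) ↔ subgroupLevel K x = i + 1 :=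
    fun i => by
      rw [Set.mem_sdiff, SetLike.mem_coe, SetLike.mem_coe, ← subgroupLevel_le_iff hK hx,
        ← subgroupLevel_le_iff hK hx]
      omega
  rw [stepWeight]
  rcases hl : subgroupLevel K x with _ | l
  · have h0 : ∀ i, ((K (i + 1) : Set G) \ (K i : Set G)).indicator (fun _ => n i) x = 0 :=
      fun i => Set.indicator_of_notMem (fun hc => by have := (hmem i).1 hc; omega) _
    simp only [h0, tsum_zero, add_zero, stepValue]
  · rw [tsum_eq_single l]
    · rw [Set.indicator_of_mem ((hmem l).2 hl)]; rfl
    · intro i hi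
      refine Set.indicator_of_notMem (fun hc => hi ?_) _
      have := (hmem i).1 hc
      omega

theorem monotone_stepValue {n : ℕ → ℝ} (hn : Monotone n) (hn1 : ∀ i, 1 ≤ n i) :
    Monotone (stepValue n) := by
  refine monotone_nat_of_le_succ fun i => ?_
  cases i with
  | zero => simp only [stepValue]; linarith [hn1 0]
  | succ i => simp only [stepValue]; linarith [hn (Nat.le_succ i)]

theorem one_le_stepValue {n : ℕ → ℝ} (hn1 : ∀ i, 1 ≤ n i) (i : ℕ) : 1 ≤ stepValue n i := by
  cases i with
  | zero => exact le_rfl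
  | succ i => simp only [stepValue]; linarith [hn1 i]

theorem subgroupLevel_mul_le (hK : Monotone K) (hx : ∀ x, ∃ i, x ∈ K i) (x y : G) :
    subgroupLevel K (x * y) ≤ max (subgroupLevel K x) (subgroupLevel K y) := by
  rw [subgroupLevel_le_iff hK hx]
  exact mul_mem ((subgroupLevel_le_iff hK hx).1 (le_max_left _ _))
    ((subgroupLevel_le_iff hK hx).1 (le_max_right _ _))

theorem subgroupLevel_inv (hK : Monotone K) (hx : ∀ x, ∃ i, x ∈ K i) (x : G) :
    subgroupLevel K x⁻¹ = subgroupLevel K x := by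
  refine eq_of_forall_ge_iff fun i => ?_
  rw [subgroupLevel_le_iff hK hx, subgroupLevel_le_iff hK hx, inv_mem_iff]

end StepWeight

/-- The conclusion of the theorem: the unitization of `L^p(G,ω) ∩ L^2(G)` is a Banach algebra that
admits norm-controlled inversion in `B(L^2(G))`. -/
theorem IsControlledWeight.exists_unitization {G : Type*} [Group G] [TopologicalSpace G]
    [IsTopologicalGroup G] [LocallyCompactSpace G] [T2Space G] [MeasurableSpace G] [BorelSpace G]
    (hG : ¬ DiscreteTopology G) {μ : Measure G} [μ.IsHaarMeasure] [μ.Regular]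
    {p : ℝ≥0∞} [Fact (1 ≤ p)] (hp : p ≠ ∞) {ω σ : G → ℝ} {C D : ℝ≥0} {θ : ℝ}
    (hσ : SigmaCompactSpace G) (hi : μ.IsInvInvariant)
    (h : IsControlledWeight μ p ω σ C D θ) :
    ∃ 𝔄 : UnitalBanachAlgebra (UnitizedSpace p ω μ), IsConvolutionUnitization 𝔄 ∧
      ∃ ι : 𝔄.Embedding (Lp ℂ 2 μ →L[ℂ] Lp ℂ 2 μ), IsConvolutionAction ι ∧
        ι.AdmitsNormControlledInversion :=
  ⟨_, isConvolutionUnitization hp h hG, _, isConvolutionAction hp h hG,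
    admitsNormControlledInversion hp h hG⟩

/-! ### Step and polynomial weights are controlled -/

/-- Spreading $(1+m)^{-t}$ over the $m+1$ indices in $[m,2m]$ gains one power of decay. With balls
in place of spheres, exponents $t$ just above $d$ therefore suffice for growth of degree $d$. -/
theorem polyTail_le {t : ℝ} (ht : 0 < t) (m : ℕ) :
    ENNReal.ofReal ((1 + (m : ℝ)) ^ (-t)) ≤ ∑' n : ℕ, if m ≤ n then
      ENNReal.ofReal (2 ^ (t + 1) * (1 + (n : ℝ)) ^ (-(t + 1))) else 0 := by
  have hm : (0 : ℝ) < 1 + m := by positivity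
  refine le_trans ?_ (ENNReal.sum_le_tsum (Finset.Icc m (2 * m)))
  calc ENNReal.ofReal ((1 + (m : ℝ)) ^ (-t))
      = ∑ n ∈ Finset.Icc m (2 * m), ENNReal.ofReal ((1 + (m : ℝ)) ^ (-(t + 1))) := by
        have hc : (Finset.Icc m (2 * m)).card = m + 1 := by rw [Nat.card_Icc]; omega
        rw [Finset.sum_const, hc, nsmul_eq_mul, ← ENNReal.ofReal_natCast, ← ENNReal.ofReal_mul
          (by positivity)]
        congr 1
        push_cast
        rw [neg_add, Real.rpow_add hm, Real.rpow_neg_one, add_comm (m : ℝ) 1]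
        field_simp
    _ ≤ _ := by
        refine Finset.sum_le_sum fun n hn => ?_
        rw [Finset.mem_Icc] at hn
        rw [if_pos hn.1]
        refine ENNReal.ofReal_le_ofReal ?_
        have hn0 : (0 : ℝ) < 1 + n := by positivity
        have h1 : ((1 + n : ℝ) / 2) ≤ 1 + m := by
          have : (n : ℝ) ≤ 2 * m := by exact_mod_cast hn.2
          linarith
        calc (1 + (m : ℝ)) ^ (-(t + 1)) ≤ ((1 + n : ℝ) / 2) ^ (-(t + 1)) :=
              Real.rpow_le_rpow_of_nonpos (by positivity) h1 (by linarith)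
          _ = _ := by
              rw [Real.div_rpow hn0.le two_pos.le, Real.rpow_neg two_pos.le, div_inv_eq_mul,
                mul_comm]

theorem HasGrowthOfDegreeLE.measure_pow_le {G : Type*} [Group G] [TopologicalSpace G]
    [IsTopologicalGroup G] [MeasurableSpace G] {μ : Measure G} {d : ℕ} (hd : HasGrowthOfDegreeLE μ d)
    {U : Set G}
    (hU : IsGeneratingNhd U) : ∃ C : ℝ, 0 ≤ C ∧ ∀ n : ℕ,
      μ (U ^ n) ≤ ENNReal.ofReal (C * (1 + (n : ℝ)) ^ (d : ℝ)) := by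
  obtain ⟨V, hV, C, hC⟩ := hd
  obtain ⟨m, hm1, hm⟩ := hU.exists_pow_subset hV
  refine ⟨max C 0 * m ^ d, by positivity, fun n => ?_⟩
  -- The growth bound is only given for positive exponents, so $U^n$ is enlarged to $U^{n+1}$.
  refine (measure_mono ((hU.pow_mono (Nat.le_succ n)).trans (hm (n + 1)))).trans
    ((hC _ (Nat.mul_pos hm1 n.succ_pos)).trans (ENNReal.ofReal_le_ofReal ?_))
  rw [Real.rpow_natCast, mul_assoc, ← mul_pow]
  push_cast
  rw [add_comm (n : ℝ) 1]
  gcongr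
  exact le_max_left _ _

theorem tsum_ofReal_mul_measure_ne_top {G : Type*} [MeasurableSpace G] {μ : Measure G}
    {a b : ℕ → ℝ} {S : ℕ → Set G} (ha : ∀ n, 0 ≤ a n)
    (hb : ∀ n, μ (S n) ≤ ENNReal.ofReal (b n)) (hs : Summable fun n => a n * b n) :
    ∑' n, ENNReal.ofReal (a n) * μ (S n) ≠ ∞ := by
  refine ne_top_of_le_ne_top hs.tsum_ofReal_ne_top (ENNReal.tsum_le_tsum fun n => ?_)
  rw [ENNReal.ofReal_mul (ha n)]
  gcongr
  exact hb n

theorem ENNReal.toReal_inv_mul_lt_one {q : ℝ≥0∞} {s : ℝ} (hs0 : 0 < s) (hs : ENNReal.ofReal s < q) :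
    s * (q⁻¹).toReal < 1 := by
  rcases eq_or_ne q ∞ with rfl | hq
  · simp
  · have h1 := (ENNReal.ofReal_lt_iff_lt_toReal hs0.le hq).1 hs
    rw [ENNReal.toReal_inv, ← div_eq_mul_inv, div_lt_one (hs0.trans h1)]
    exact h1

section Cases

variable {G : Type*} [Group G] [TopologicalSpace G] [T2Space G] [MeasurableSpace G] [BorelSpace G]
  {μ : Measure G} {p q : ℝ≥0∞}

theorem isInvInvariant_of_compact_exhaustion [IsTopologicalGroup G] [LocallyCompactSpace G]
    [μ.IsHaarMeasure] [μ.Regular] {K : ℕ → Subgroup G}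
    (hKc : ∀ i, IsCompact (K i : Set G)) (hK : Monotone K) (hx : ∀ x, ∃ i, x ∈ K i) :
    μ.IsInvInvariant := by
  -- The first subgroups may be null. A later one that contains `g` has positive finite measure and
  -- is fixed by right translation by powers of `g`.
  obtain ⟨j, hj⟩ : ∃ j, μ (K j : Set G) ≠ 0 := by
    by_contra! hc
    have h1 : μ (⋃ i, (K i : Set G)) = 0 := measure_iUnion_null hc
    rw [Set.eq_univ_of_forall fun x => Set.mem_iUnion.2 (hx x)] at h1
    exact isOpen_univ.measure_ne_zero μ Set.univ_nonempty h1
  refine isInvInvariant_of_subexponential fun g => ?_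
  obtain ⟨i, hi⟩ := hx g
  refine ⟨K (max i j), (hKc _).measurableSet, fun h0 => hj
    (measure_mono_null (hK (le_max_right i j)) h0), (hKc _).measure_lt_top.ne, fun ε hε =>
    ⟨(μ (K (max i j) : Set G)).toReal, fun n _ => ?_⟩⟩
  have e : (fun x => x * g ^ n) ⁻¹' (K (max i j) : Set G) = K (max i j) := by
    ext x
    simp only [Set.mem_preimage, SetLike.mem_coe]
    exact Subgroup.mul_mem_cancel_right _ (pow_mem (hK (le_max_left i j) hi) n)
  rw [e]
  refine (ENNReal.ofReal_toReal (hKc _).measure_lt_top.ne).symm.le.trans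
    (ENNReal.ofReal_le_ofReal ?_)
  exact le_mul_of_one_le_right ENNReal.toReal_nonneg (Real.one_le_exp (by positivity))

/-- The level is ultrametric, so $\omega(xy)\le\max(\omega(x),\omega(y))$ and the auxiliary weight
can be taken to be 1. -/
theorem exists_isControlledWeight_stepWeight (hp1 : 1 ≤ p) (hp : p ≠ ∞)
    (hpq : p.HolderConjugate q) {K : ℕ → Subgroup G} {n : ℕ → ℝ} {s : ℝ}
    (hKc : ∀ i, IsCompact (K i : Set G)) (hK : Monotone K) (hx : ∀ x, ∃ i, x ∈ K i)
    (hn : Monotone n) (hn1 : ∀ i, 1 ≤ n i) (hs0 : 0 < s) (hs : ENNReal.ofReal s < q)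
    (hint : MemLp (fun x => (stepWeight K n x)⁻¹) (ENNReal.ofReal s) μ) :
    ∃ σ C D θ, IsControlledWeight μ p (stepWeight K n) σ C D θ := by
  have hω : stepWeight K n = fun x => stepValue n (subgroupLevel K x) :=
    funext (stepWeight_eq hK hx n)
  have hω1 : ∀ x, 1 ≤ stepWeight K n x := fun x => by rw [hω]; exact one_le_stepValue hn1 _
  have hm : Measurable (subgroupLevel K) := by
    refine measurable_of_Iic fun i => ?_
    have : subgroupLevel K ⁻¹' Set.Iic i = K i := by
      ext x
      simp [subgroupLevel_le_iff hK hx]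
    rw [this]
    exact (hKc i).measurableSet
  obtain ⟨D, θ, h⟩ := exists_isControlledWeight (μ := μ) hp1 hp hpq (ω := stepWeight K n)
    (by rw [hω]; exact (measurable_from_nat (f := stepValue n)).comp hm) hω1
    (fun x => by rw [hω]; simp only [subgroupLevel_inv hK hx]) (γ := 0) (s := s) le_rfl 1
    (fun x y => by
      rw [Real.rpow_zero, Real.rpow_zero, mul_one, one_mul, NNReal.coe_one, one_mul]
      have h1 := hω1 x
      have h2 := hω1 y
      have h3 := monotone_stepValue hn hn1 (subgroupLevel_mul_le hK hx x y)
      rw [(monotone_stepValue hn hn1).map_max] at h3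
      simp only [hω] at h1 h2 ⊢
      rcases max_choice (stepValue n (subgroupLevel K x)) (stepValue n (subgroupLevel K y))
        with h4 | h4 <;> rw [h4] at h3 <;> linarith)
    hs0 (by simpa using ENNReal.toReal_inv_mul_lt_one hs0 hs) (by
      have h1 := lintegral_rpow_enorm_lt_top_of_eLpNorm_lt_top (by simpa using hs0)
        ENNReal.ofReal_ne_top hint.2
      rw [ENNReal.toReal_ofReal hs0.le] at h1
      refine (lintegral_congr fun x => ?_).trans_lt h1 |>.ne
      have h0 : 0 < stepWeight K n x := zero_lt_one.trans_le (hω1 x)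
      rw [Real.enorm_of_nonneg (by positivity), ENNReal.ofReal_inv_of_pos h0, ENNReal.inv_rpow,
        ENNReal.rpow_neg])
  exact ⟨_, _, D, θ, h⟩

/-- The length of a product is at most twice the larger length, so
$\omega(xy)\le2^\beta\max(\omega(x),\omega(y))$ and $\gamma=0$ works. -/
theorem exists_isControlledWeight_polyWeight [IsTopologicalGroup G] (hp1 : 1 ≤ p) (hp : p ≠ ∞)
    (hpq : p.HolderConjugate q) {U : Set G} {β : ℝ} (hU : IsGeneratingNhd U)
    {d : ℕ} (hd : HasGrowthOfDegreeLE μ d) (hβ : 0 < β)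
    (hdβ : (d : ℝ≥0∞) / q < ENNReal.ofReal β) :
    ∃ σ C D θ, IsControlledWeight μ p (polyWeight U β) σ C D θ := by
  have hω1 : ∀ x, 1 ≤ polyWeight U β x := fun x =>
    Real.one_le_rpow (le_add_of_nonneg_right (Nat.cast_nonneg _)) hβ.le
  have hq1 : (q⁻¹).toReal ≤ 1 := by
    rw [hpq.toReal_inv_eq]
    linarith [show 0 ≤ 1 / p.toReal by positivity]
  have hdq : d * (q⁻¹).toReal < β := by
    rw [div_eq_mul_inv] at hdβ
    have h1 := (ENNReal.toReal_lt_toReal hdβ.ne_top ENNReal.ofReal_ne_top).2 hdβ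
    rwa [ENNReal.toReal_mul, ENNReal.toReal_natCast, ENNReal.toReal_ofReal hβ.le] at h1
  set Q := (q⁻¹).toReal
  have hQ0 : 0 ≤ Q := ENNReal.toReal_nonneg
  -- Half the gap between $\beta$ and $d/q$: then $\omega^{-s}=(1+\tau)^{-(d+\delta)}$ is
  -- integrable, while $s/q<1$.
  set δ := (β - d * Q) / 2 with hδ
  have hδ0 : 0 < δ := by rw [hδ]; linarith
  set s := (d + δ) / β with hs
  have hs0 : 0 < s := by positivity
  have hβs : β * s = d + δ := by rw [hs]; field_simp
  obtain ⟨B, hB0, hB⟩ := hd.measure_pow_le hU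
  obtain ⟨D, θ, h⟩ := exists_isControlledWeight (μ := μ) hp1 hp hpq (ω := polyWeight U β)
    ((measurable_from_nat (f := fun n : ℕ => (1 + (n : ℝ)) ^ β)).comp hU.measurable_lengthFun) hω1
    (fun x => by simp only [polyWeight, hU.lengthFun_inv]) (γ := 0) (s := s) le_rfl
    (Real.toNNReal (2 ^ β)) (fun x y => by
      rw [Real.rpow_zero, Real.rpow_zero, mul_one, one_mul, Real.coe_toNNReal _ (by positivity)]
      simp only [polyWeight]
      have hl : (lengthFun U (x * y) : ℝ) ≤ lengthFun U x + lengthFun U y := by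
        exact_mod_cast hU.lengthFun_mul_le x y
      set a := (lengthFun U x : ℝ)
      set b := (lengthFun U y : ℝ)
      have ha : 0 ≤ a := Nat.cast_nonneg _
      have hb : 0 ≤ b := Nat.cast_nonneg _
      rw [mul_add, ← Real.mul_rpow two_pos.le (by positivity),
        ← Real.mul_rpow two_pos.le (by positivity)]
      rcases le_total a b with hab | hab
      · exact (Real.rpow_le_rpow (by positivity) (by linarith) hβ.le).trans
          (le_add_of_nonneg_left (by positivity))
      · exact (Real.rpow_le_rpow (by positivity) (by linarith) hβ.le).trans
          (le_add_of_nonneg_right (by positivity)))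
    hs0 (by
      rw [sub_zero, ← mul_lt_mul_iff_right₀ hβ, ← mul_assoc, hβs, mul_one]
      nlinarith) (by
      refine ne_top_of_le_ne_top ?_ (hU.lintegral_lengthFun_le (μ := μ)
        (fun m => ENNReal.ofReal ((1 + (m : ℝ)) ^ (-((d : ℝ) + δ)))) _
        (polyTail_le (by positivity)) |>.trans' (lintegral_mono fun x => ?_))
      · refine tsum_ofReal_mul_measure_ne_top (fun n => by positivity) hB ?_
        have h1 : Summable fun n : ℕ =>
            (2 ^ ((d : ℝ) + δ + 1) * B) * (1 + (n : ℝ)) ^ (-(1 + δ)) := by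
          refine Summable.mul_left _ ?_
          have := (summable_nat_add_iff 1).2
            (Real.summable_nat_rpow.2 (show -(1 + δ) < -1 by linarith))
          simpa [add_comm] using this
        refine h1.congr fun n => ?_
        have : (0 : ℝ) < 1 + n := by positivity
        rw [show -(1 + δ) = -((d : ℝ) + δ + 1) + d by ring, Real.rpow_add this]
        ring
      · have h0 : (0 : ℝ) < 1 + lengthFun U x := by positivity
        simp only [polyWeight]
        rw [ENNReal.ofReal_rpow_of_pos (by positivity), ← Real.rpow_mul h0.le, mul_neg, hβs])
  exact ⟨_, _, D, θ, h⟩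

end Cases

/-! ### Subexponential weights are controlled -/

section Subexponential

/-- Both $a$ and $2b$ lie between $b$ and $a+b$, as convex combinations with the weights $b/a$ and
$1-b/a$ interchanged; add the two concavity inequalities. The gain is the coefficient $2^\alpha-1<1$
when $\alpha<1$. -/
theorem Real.add_rpow_le_of_le {a b α : ℝ} (hb : 0 ≤ b) (hab : b ≤ a) (hα0 : 0 < α) (hα1 : α ≤ 1) :
    (a + b) ^ α ≤ a ^ α + (2 ^ α - 1) * b ^ α := by
  rcases hb.eq_or_lt with rfl | hb
  · simp [Real.zero_rpow hα0.ne']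
  have ha : 0 < a := hb.trans_le hab
  have hc := Real.concaveOn_rpow hα0.le hα1
  have hl0 : 0 ≤ b / a := by positivity
  have hl1 : 0 ≤ 1 - b / a := by rw [sub_nonneg, div_le_one ha]; exact hab
  have h1 := hc.2 (Set.mem_Ici.2 hb.le) (Set.mem_Ici.2 (show 0 ≤ a + b by positivity)) hl0 hl1
    (by ring)
  have h2 := hc.2 (Set.mem_Ici.2 hb.le) (Set.mem_Ici.2 (show 0 ≤ a + b by positivity)) hl1 hl0
    (by ring)
  simp only [smul_eq_mul] at h1 h2
  have e1 : b / a * b + (1 - b / a) * (a + b) = a := by field_simp; ring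
  have e2 : (1 - b / a) * b + b / a * (a + b) = 2 * b := by field_simp; ring
  rw [e1] at h1
  rw [e2, Real.mul_rpow two_pos.le hb.le] at h2
  linarith

/-- Since $\alpha_0<\alpha$, the total exponent is eventually below $-2\log n$. -/
theorem summable_exp_neg_rpow_mul_exp_rpow {α₀ α k B c : ℝ} (hα₀ : 0 < α₀) (hα : α₀ < α)
    (hk : 0 < k) (hB : 0 ≤ B) (hc : 0 ≤ c) :
    Summable fun n : ℕ => Real.exp (-k * (n : ℝ) ^ α) *
      (B * Real.exp (c * (1 + (n : ℝ)) ^ α₀)) := by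
  have hlim : Filter.Tendsto (fun n : ℕ => (n : ℝ) ^ (α - α₀)) Filter.atTop Filter.atTop :=
    (tendsto_rpow_atTop (by linarith)).comp tendsto_natCast_atTop_atTop
  refine Summable.of_norm_bounded_eventually_nat (g := fun n : ℕ => B * (n : ℝ) ^ (-2 : ℝ))
    ((Real.summable_nat_rpow.2 (by norm_num)).mul_left B) ?_
  filter_upwards [hlim.eventually_ge_atTop ((c * 2 ^ α₀ + 2 / α₀) / k),
    Filter.eventually_ge_atTop 1] with n hn hn1
  have hn0 : (1 : ℝ) ≤ n := by exact_mod_cast hn1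
  have hnp : (0 : ℝ) < n := by linarith
  rw [div_le_iff₀ hk] at hn
  have h1 : (1 + (n : ℝ)) ^ α₀ ≤ 2 ^ α₀ * (n : ℝ) ^ α₀ := by
    rw [← Real.mul_rpow two_pos.le hnp.le]
    exact Real.rpow_le_rpow (by positivity) (by linarith) hα₀.le
  have h2 : Real.log n ≤ (n : ℝ) ^ α₀ / α₀ := Real.log_le_rpow_div hnp.le hα₀
  have h3 : (n : ℝ) ^ α = (n : ℝ) ^ (α - α₀) * (n : ℝ) ^ α₀ := by
    rw [← Real.rpow_add hnp]; congr 1; ring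
  have h4 : -k * (n : ℝ) ^ α + c * (1 + (n : ℝ)) ^ α₀ ≤ Real.log n * (-2) := by
    have h5 := mul_le_mul_of_nonneg_right hn (show 0 ≤ (n : ℝ) ^ α₀ by positivity)
    have h6 := mul_le_mul_of_nonneg_left h1 hc
    rw [h3]
    have h7 : 2 / α₀ * (n : ℝ) ^ α₀ = 2 * ((n : ℝ) ^ α₀ / α₀) := by ring
    nlinarith
  rw [Real.norm_of_nonneg (by positivity), mul_left_comm, ← Real.exp_add,
    Real.rpow_def_of_pos hnp (-2)]
  gcongr

variable {G : Type*} [Group G] [TopologicalSpace G] [IsTopologicalGroup G] [MeasurableSpace G]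
  {μ : Measure G} {U : Set G}

theorem HasGrowthBoundedByExpPow.measure_pow_le {a : ℝ}
    (h : HasGrowthBoundedByExpPow μ a) (hU : IsGeneratingNhd U) :
    ∃ B c : ℝ, 0 ≤ B ∧ 0 ≤ c ∧ ∀ n : ℕ,
      μ (U ^ n) ≤ ENNReal.ofReal (B * Real.exp (c * (1 + (n : ℝ)) ^ a)) := by
  obtain ⟨V, hV, C, hC⟩ := h
  obtain ⟨m, hm1, hm⟩ := hU.exists_pow_subset hV
  refine ⟨max C 0, (m : ℝ) ^ a, le_max_right _ _, by positivity, fun n => ?_⟩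
  refine (measure_mono ((hU.pow_mono (Nat.le_succ n)).trans (hm (n + 1)))).trans
    ((hC _ (Nat.mul_pos hm1 n.succ_pos)).trans (ENNReal.ofReal_le_ofReal ?_))
  rw [← Real.mul_rpow (by positivity) (by positivity)]
  push_cast
  rw [add_comm (n : ℝ) 1]
  gcongr
  exact le_max_left _ _

theorem HasGrowthOfDegreeLE.measure_pow_le_exp {d : ℕ} {a : ℝ} (ha : 0 < a)
    (h : HasGrowthOfDegreeLE μ d) (hU : IsGeneratingNhd U) :
    ∃ B c : ℝ, 0 ≤ B ∧ 0 ≤ c ∧ ∀ n : ℕ,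
      μ (U ^ n) ≤ ENNReal.ofReal (B * Real.exp (c * (1 + (n : ℝ)) ^ a)) := by
  obtain ⟨B, hB0, hB⟩ := h.measure_pow_le hU
  refine ⟨B, d / a, hB0, by positivity, fun n => (hB n).trans (ENNReal.ofReal_le_ofReal ?_)⟩
  have hn : (0 : ℝ) < 1 + n := by positivity
  rw [Real.rpow_def_of_pos hn]
  refine mul_le_mul_of_nonneg_left (Real.exp_le_exp.2 ?_) hB0
  calc Real.log (1 + n) * d ≤ ((1 + (n : ℝ)) ^ a / a) * d := by
        gcongr; exact Real.log_le_rpow_div hn.le ha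
    _ = _ := by ring

theorem HasGrowthOfDegreeLE.exists_measure_pow_le_exp_mul {d : ℕ} (h : HasGrowthOfDegreeLE μ d)
    (hU : IsGeneratingNhd U) {ε : ℝ} (hε : 0 < ε) : ∃ C : ℝ, ∀ n : ℕ, 1 ≤ n →
      μ (U ^ n) ≤ ENNReal.ofReal (C * Real.exp (ε * n)) := by
  obtain ⟨B, hB0, hB⟩ := h.measure_pow_le hU
  -- $\delta\le1$ gives $\delta(1+n)\le1+\delta n\le e^{\delta n}$, and $d\delta\le\varepsilon$
  -- controls the $d$-th power.
  set δ := min 1 (ε / (d + 1)) with hδ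
  have hδ0 : 0 < δ := lt_min one_pos (by positivity)
  have hδ1 : δ ≤ 1 := min_le_left _ _
  have hδε : d * δ ≤ ε := by
    calc (d : ℝ) * δ ≤ (d + 1) * (ε / (d + 1)) := by
          gcongr
          · linarith
          · exact min_le_right _ _
      _ = ε := by field_simp
  refine ⟨B * (1 / δ) ^ d, fun n _ => (hB n).trans (ENNReal.ofReal_le_ofReal ?_)⟩
  have h1 : 1 + (n : ℝ) ≤ 1 / δ * Real.exp (δ * n) := by
    rw [div_mul_eq_mul_div, one_mul, le_div_iff₀ hδ0]
    nlinarith [Real.add_one_le_exp (δ * n)]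
  rw [Real.rpow_natCast, mul_assoc]
  gcongr
  calc (1 + (n : ℝ)) ^ d ≤ (1 / δ * Real.exp (δ * n)) ^ d := by gcongr
    _ = (1 / δ) ^ d * Real.exp (d * δ * n) := by
        rw [mul_pow, ← Real.exp_nat_mul, mul_assoc]
    _ ≤ _ := by gcongr

theorem exists_isControlledWeight_subexpWeight [T2Space G] [BorelSpace G] {p q : ℝ≥0∞}
    (hp1 : 1 ≤ p) (hp : p ≠ ∞) (hpq : p.HolderConjugate q)
    {α₀ α C : ℝ} (hU : IsGeneratingNhd U) (hα₀ : 0 < α₀) (hα : α₀ < α) (hα1 : α < 1) (hC : 0 < C)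
    (hg : ∃ B c : ℝ, 0 ≤ B ∧ 0 ≤ c ∧ ∀ n : ℕ,
      μ (U ^ n) ≤ ENNReal.ofReal (B * Real.exp (c * (1 + (n : ℝ)) ^ α₀))) :
    ∃ σ C' D θ, IsControlledWeight μ p (subexpWeight U α C) σ C' D θ := by
  obtain ⟨B, c, hB, hc, hg⟩ := hg
  have hα0 : 0 < α := hα₀.trans hα
  have hq1 : (q⁻¹).toReal ≤ 1 := by
    rw [hpq.toReal_inv_eq]
    linarith [show 0 ≤ 1 / p.toReal by positivity]
  set γ : ℝ := 2 ^ α - 1 with hγ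
  have hγ0 : 0 ≤ γ := sub_nonneg.2 (Real.one_le_rpow one_le_two hα0.le)
  have hγ1 : γ < 1 := by
    have : (2 : ℝ) ^ α < 2 ^ (1 : ℝ) := Real.rpow_lt_rpow_of_exponent_lt one_lt_two hα1
    rw [Real.rpow_one] at this
    rw [hγ]
    linarith
  -- Any positive $s<1-\gamma$ would do: $\omega^{-s}$ is integrable for every $s>0$, because the
  -- growth has a smaller exponent than the weight.
  set s := (1 - γ) / 2 with hs
  have hs0 : 0 < s := by rw [hs]; linarith
  have hmul : ∀ x y, lengthFun U y ≤ lengthFun U x →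
      subexpWeight U α C (x * y) ≤ subexpWeight U α C x * subexpWeight U α C y ^ γ :=
    fun x y hxy => by
      simp only [subexpWeight]
      rw [← Real.exp_mul, ← Real.exp_add, Real.exp_le_exp]
      have h1 := Real.add_rpow_le_of_le (Nat.cast_nonneg (lengthFun U y))
        (show (lengthFun U y : ℝ) ≤ lengthFun U x by exact_mod_cast hxy) hα0 hα1.le
      have h2 : (lengthFun U (x * y) : ℝ) ^ α ≤ ((lengthFun U x : ℝ) + lengthFun U y) ^ α := by
        refine Real.rpow_le_rpow (Nat.cast_nonneg _) ?_ hα0.le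
        exact_mod_cast hU.lengthFun_mul_le x y
      calc _ ≤ C * ((lengthFun U x : ℝ) ^ α + γ * (lengthFun U y : ℝ) ^ α) := by
            gcongr; exact h2.trans h1
        _ = _ := by ring
  have hpos : ∀ x, 0 < subexpWeight U α C x := fun x => Real.exp_pos _
  have hsymm : ∀ x, subexpWeight U α C x⁻¹ = subexpWeight U α C x := fun x => by
    simp only [subexpWeight, hU.lengthFun_inv]
  obtain ⟨D, θ, h⟩ := exists_isControlledWeight (μ := μ) hp1 hp hpq (ω := subexpWeight U α C)
    ((measurable_from_nat (f := fun n : ℕ => Real.exp (C * (n : ℝ) ^ α))).comp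
      hU.measurable_lengthFun)
    (fun x => Real.one_le_exp (by positivity)) hsymm (γ := γ) (s := s) hγ0 1 (fun x y => by
      rw [NNReal.coe_one, one_mul]
      have hx := hpos x
      have hy := hpos y
      rcases le_total (lengthFun U y) (lengthFun U x) with hxy | hxy
      · exact (hmul x y hxy).trans (le_add_of_nonneg_right (by positivity))
      -- The other case follows by symmetry of the weight, applied to $(xy)^{-1}=y^{-1}x^{-1}$.
      · have h1 := hmul y⁻¹ x⁻¹ (by rwa [hU.lengthFun_inv, hU.lengthFun_inv])
        rw [← mul_inv_rev, hsymm, hsymm, hsymm, mul_comm] at h1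
        exact h1.trans (le_add_of_nonneg_left (by positivity)))
    hs0 (by
      calc s * (q⁻¹).toReal ≤ s * 1 := by gcongr
        _ < 1 - γ := by rw [hs]; linarith) (by
      refine ne_top_of_le_ne_top ?_ (hU.lintegral_lengthFun_le (μ := μ)
        (fun m => ENNReal.ofReal (Real.exp (-(C * s) * (m : ℝ) ^ α)))
        (fun m => ENNReal.ofReal (Real.exp (-(C * s) * (m : ℝ) ^ α))) (fun m => ?_) |>.trans'
          (lintegral_mono fun x => ?_))
      · exact tsum_ofReal_mul_measure_ne_top (fun n => (Real.exp_pos _).le) hg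
          (summable_exp_neg_rpow_mul_exp_rpow hα₀ hα (by positivity) hB hc)
      · exact le_trans (by simp) (ENNReal.le_tsum m)
      · simp only [subexpWeight]
        rw [ENNReal.ofReal_rpow_of_pos (Real.exp_pos _), ← Real.exp_mul]
        refine ENNReal.ofReal_le_ofReal (Real.exp_le_exp.2 (le_of_eq ?_))
        ring)
  exact ⟨_, _, D, θ, h⟩

end Subexponential

theorem corollary5p11 {G : Type*} [Group G] [TopologicalSpace G] [IsTopologicalGroup G]
    [LocallyCompactSpace G] [T2Space G] [MeasurableSpace G] [BorelSpace G]
    (hG : ¬ DiscreteTopology G)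
    (μ : Measure G) [μ.IsHaarMeasure] [μ.Regular]
    (p q : ℝ≥0∞) [Fact (1 ≤ p)] (hp : p ≠ ∞) (hpq : p.HolderConjugate q)
    (ω : G → ℝ)
    (hω :
      (∃ (K : ℕ → Subgroup G) (n : ℕ → ℝ) (s : ℝ),
        (∀ i, IsCompact (K i : Set G)) ∧ Monotone K ∧ (∀ x, ∃ i, x ∈ K i) ∧
        Monotone n ∧ (∀ i, 1 ≤ n i) ∧ ω = stepWeight K n ∧
        0 < s ∧ ENNReal.ofReal s < q ∧
        MemLp (fun x => (ω x)⁻¹) (ENNReal.ofReal s) μ) ∨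
      (∃ (U : Set G) (β : ℝ), IsGeneratingNhd U ∧ HasPolynomialGrowth μ ∧
        0 < β ∧ (growthOrder μ : ℝ≥0∞) / q < ENNReal.ofReal β ∧ ω = polyWeight U β) ∨
      (∃ (U : Set G) (α C : ℝ), IsGeneratingNhd U ∧ HasPolynomialGrowth μ ∧
        0 < α ∧ α < 1 ∧ 0 < C ∧ ω = subexpWeight U α C) ∨
      (∃ (U : Set G) (α₀ α C : ℝ), IsGeneratingNhd U ∧ HasIntermediateGrowth μ ∧
        HasGrowthBoundedByExpPow μ α₀ ∧
        0 < α₀ ∧ α₀ < α ∧ α < 1 ∧ 0 < C ∧ ω = subexpWeight U α C)) :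
    ∃ 𝔄 : UnitalBanachAlgebra (UnitizedSpace p ω μ), IsConvolutionUnitization 𝔄 ∧
      ∃ ι : 𝔄.Embedding (Lp ℂ 2 μ →L[ℂ] Lp ℂ 2 μ), IsConvolutionAction ι ∧
        ι.AdmitsNormControlledInversion := by
  have hp1 : 1 ≤ p := Fact.out
  rcases hω with ⟨K, n, s, hKc, hK, hx, hn, hn1, rfl, hs0, hs, hint⟩ |
    ⟨U, β, hU, hg, hβ, hdβ, rfl⟩ | ⟨U, α, C, hU, hg, hα0, hα1, hC, rfl⟩ |
    ⟨U, α₀, α, C, hU, ⟨-, V, hV, hVg⟩, hg, hα₀, hα, hα1, hC, rfl⟩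
  · obtain ⟨σ, C, D, θ, h⟩ :=
      exists_isControlledWeight_stepWeight hp1 hp hpq hKc hK hx hn hn1 hs0 hs hint
    exact h.exists_unitization hG hp
      ⟨⟨fun i => K i, hKc, Set.eq_univ_of_forall fun x => Set.mem_iUnion.2 (hx x)⟩⟩
      (isInvInvariant_of_compact_exhaustion hKc hK hx)
  · have hd : HasGrowthOfDegreeLE μ (growthOrder μ) := Nat.sInf_mem hg
    obtain ⟨σ, C, D, θ, h⟩ := exists_isControlledWeight_polyWeight hp1 hp hpq hU hd hβ hdβ
    exact h.exists_unitization hG hp hU.sigmaCompactSpace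
      (hU.isInvInvariant fun ε hε => hd.exists_measure_pow_le_exp_mul hU hε)
  · obtain ⟨d, hd⟩ := hg
    -- Polynomial growth is dominated by $e^{cn^{\alpha_0}}$ for every $\alpha_0>0$;
    -- $\alpha_0=\alpha/2$ is one choice below $\alpha$.
    obtain ⟨σ, C, D, θ, h⟩ := exists_isControlledWeight_subexpWeight hp1 hp hpq hU
      (half_pos hα0) (half_lt_self hα0) hα1 hC (hd.measure_pow_le_exp (half_pos hα0) hU)
    exact h.exists_unitization hG hp hU.sigmaCompactSpace
      (hU.isInvInvariant fun ε hε => hd.exists_measure_pow_le_exp_mul hU hε)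
  · obtain ⟨σ, C, D, θ, h⟩ := exists_isControlledWeight_subexpWeight hp1 hp hpq hU
      hα₀ hα hα1 hC (hg.measure_pow_le hU)
    exact h.exists_unitization hG hp hU.sigmaCompactSpace (hV.isInvInvariant hVg)
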